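/- Let $d\ge 1$, let $b\in C^1(\mathbb{R}^d;\mathbb{R}^d)$ with $b$ and $\nabla b$ bounded, let $K:\mathbb{R}^d\to\mathbb{R}^d$ be bounded and Lipschitz continuous, and let $T>0$. Then there is a constant $C(T)>0$, depending only on $T$, $d$, $b$ and $K$ (in particular not on $N$, $p$, $\tau$ or the law of the initial data), such that the following holds for all integers $p\ge 2$ and $N\ge 2$ with $p\mid N$ and all $\tau>0$. Let $(X_0^i,V_0^i)$, $1\le i\le N$, be i.i.d. $\mathbb{R}^d\times\mathbb{R}^d$-valued random variables with an arbitrary common distribution, and let $\xi_0,\xi_1,\xi_2,\dots$ be i.i.d. random divisions, independent of the initial data, each uniformly distributed over all divisions of $\{1,\dots,N\}$ into $N/p$ batches of size $p$. Let $(X^i,V^i)_{i=1}^N$ solve on $[0,T]$ the fully coupled second-order system \[ \dot X^i=V^i,\qquad \dot V^i=b(X^i)+\frac1{N-1}\sum_{j\ne i}K(X^i-X^j), \] and let $(\tilde X^i,U^i)_{i=1}^N$ be the process generated by the Random Batch Method without replacement (RBM-1) with time step $\tau$: it is continuous on $[0,T]$ and, for every $m\ge 0$, satisfies for $t\in[m\tau,(m+1)\tau)\cap[0,T]$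 \[ \dot{\tilde X}^i=U^i,\qquad \dot U^i=b(\tilde X^i)+\frac1{p-1}\sum_{j\in\mathcal{C},\,j\ne i}K(\tilde X^i-\tilde X^j), \] where $\mathcal{C}$ is the batch of $\xi_m$ that contains $i$. The two systems share the initial data: $X^i(0)=\tilde X^i(0)=X_0^i$ and $V^i(0)=U^i(0)=V_0^i$ for all $i$. Then, for every $i\in\{1,\dots,N\}$, \[ \sup_{0\le t\le T}\Big(\mathbb{E}\,\frac1N\sum_{j=1}^N\big(|X^j(t)-\tilde X^j(t)|^2+|V^j(t)-U^j(t)|^2\big)\Big)^{1/2} =\sup_{0\le t\le T}\Big(\mathbb{E}\big(|X^i(t)-\tilde X^i(t)|^2+|V^i(t)-U^i(t)|^2\big)\Big)^{1/2} \le C(T)\sqrt{\frac{\tau}{p-1}}. \] -/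

import Mathlib

open MeasureTheory ProbabilityTheory Set
open scoped ENNReal

/-- A division of the particles `{1, …, N}` into (unlabelled) batches of size `p`. -/
def BatchDivision (N p : ℕ) : Type :=
  {π : Finpartition (Finset.univ : Finset (Fin N)) // ∀ C ∈ π.parts, C.card = p}

noncomputable instance (N p : ℕ) : Fintype (BatchDivision N p) := by
  classical
  unfold BatchDivision
  infer_instance

/-- Divisions form a finite set, on which every subset is measurable. -/
instance (N p : ℕ) : MeasurableSpace (BatchDivision N p) := ⊤

namespace BatchDivision

variable {N p : ℕ}

/-- The batch in which the particle `i` lives. -/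
def batch (ξ : BatchDivision N p) (i : Fin N) : Finset (Fin N) := ξ.1.part i

end BatchDivision

/-- A random division is uniformly distributed over all divisions into batches of size `p`. -/
def IsUniformDivision {Ω : Type*} [MeasurableSpace Ω] (P : Measure Ω) {N p : ℕ}
    (ξ : Ω → BatchDivision N p) : Prop :=
  Measurable ξ ∧
    ∀ π : BatchDivision N p, P {ω | ξ ω = π} = (Fintype.card (BatchDivision N p) : ℝ≥0∞)⁻¹

/-- Full interaction force on particle `i` in the configuration `x`:
`1/(N-1) ∑_{j ≠ i} K(x^i - x^j)`. -/
noncomputable def fullForce {d N : ℕ}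
    (K : EuclideanSpace ℝ (Fin d) → EuclideanSpace ℝ (Fin d))
    (x : Fin N → EuclideanSpace ℝ (Fin d)) (i : Fin N) : EuclideanSpace ℝ (Fin d) :=
  (1 / ((N : ℝ) - 1)) • ∑ j ∈ Finset.univ.erase i, K (x i - x j)

/-- Random batch force on particle `i`: `1/(p-1) ∑_{j ∈ C, j ≠ i} K(x^i - x^j)`, where `C` is the
batch of `i` in the division `ξ`. -/
noncomputable def batchForce {d N p : ℕ}
    (K : EuclideanSpace ℝ (Fin d) → EuclideanSpace ℝ (Fin d)) (ξ : BatchDivision N p)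
    (x : Fin N → EuclideanSpace ℝ (Fin d)) (i : Fin N) : EuclideanSpace ℝ (Fin d) :=
  (1 / ((p : ℝ) - 1)) • ∑ j ∈ (ξ.batch i).erase i, K (x i - x j)

/-- `(x, v)` solves on `[0, T]` the fully coupled second order system
`ẋ^i = v^i`, `v̇^i = b(x^i) + 1/(N-1) ∑_{j ≠ i} K(x^i - x^j)` with initial data `(x₀, v₀)`. -/
structure IsFullSolution {d N : ℕ}
    (b K : EuclideanSpace ℝ (Fin d) → EuclideanSpace ℝ (Fin d)) (T : ℝ)
    (x₀ v₀ : Fin N → EuclideanSpace ℝ (Fin d))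
    (x v : ℝ → Fin N → EuclideanSpace ℝ (Fin d)) : Prop where
  init_pos : x 0 = x₀
  init_vel : v 0 = v₀
  deriv_pos : ∀ i, ∀ t ∈ Icc 0 T, HasDerivWithinAt (fun s => x s i) (v t i) (Icc 0 T) t
  deriv_vel : ∀ i, ∀ t ∈ Icc 0 T,
    HasDerivWithinAt (fun s => v s i) (b (x t i) + fullForce K (x t) i) (Icc 0 T) t

/-- `(x, u)` is the path produced on `[0, T]` by RBM-1 with time step `τ` from the initial data
`(x₀, v₀)`: it is continuous and, on the part of each step `[m τ, (m + 1) τ)` that lies in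
`[0, T]`, it solves `ẋ^i = u^i`, `u̇^i = b(x^i) + 1/(p-1) ∑_{j ∈ C, j ≠ i} K(x^i - x^j)`, where
`C` is the batch of `i` in the division `ξ m` drawn at time `m τ`. -/
structure IsRBMSolution {d N p : ℕ}
    (b K : EuclideanSpace ℝ (Fin d) → EuclideanSpace ℝ (Fin d)) (τ T : ℝ)
    (ξ : ℕ → BatchDivision N p)
    (x₀ v₀ : Fin N → EuclideanSpace ℝ (Fin d))
    (x u : ℝ → Fin N → EuclideanSpace ℝ (Fin d)) : Prop where
  init_pos : x 0 = x₀
  init_vel : u 0 = v₀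
  cont_pos : ContinuousOn x (Icc 0 T)
  cont_vel : ContinuousOn u (Icc 0 T)
  deriv_pos : ∀ (m : ℕ) (i : Fin N), ∀ t ∈ Icc 0 T ∩ Ico (m * τ) ((m + 1) * τ),
    HasDerivWithinAt (fun s => x s i) (u t i) (Icc 0 T ∩ Ico (m * τ) ((m + 1) * τ)) t
  deriv_vel : ∀ (m : ℕ) (i : Fin N), ∀ t ∈ Icc 0 T ∩ Ico (m * τ) ((m + 1) * τ),
    HasDerivWithinAt (fun s => u s i) (b (x t i) + batchForce K (ξ m) (x t) i)
      (Icc 0 T ∩ Ico (m * τ) ((m + 1) * τ)) t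

/-- The root mean square `(𝔼 f)^{1/2}` of a nonnegative squared error `f`, with values in
`[0, ∞]`. -/
noncomputable def rootMean {Ω : Type*} [MeasurableSpace Ω] (P : Measure Ω) (f : Ω → ℝ) : ℝ≥0∞ :=
  (∫⁻ ω, ENNReal.ofReal (f ω) ∂P) ^ (1 / 2 : ℝ)

/-! Both systems are equations `ẍ = force(x)` on the Hilbert space of configurations. At a fixed
configuration the batch force, averaged over all divisions, equals the full force, and its mean
square deviation `B ^ 2` from it is at most `N * M ^ 2 / (p - 1)`, where `M` bounds `K`. The
Lipschitz constants of the forces depend on neither `N` nor `p`.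

The division drawn for a step is independent of the state at its start, so this state can be frozen
and the expectation becomes a finite average over divisions. Over a step of length `θ`, compare the
batch flow `q` with the reference full flow `a` through the full flow `y` issued from the same point
as `q`. In the derivative of the squared error the dangerous term pairs the velocity error with the
force fluctuation at `y`. The part of the pairing with `y - a` averages to zero, because `y` and `a`
do not see the division. The part with `q - y` is of order `θ * B ^ 2`, because in mean square `q -
y` is of order `θ * B` (`sum_phaseSq_le_of_eq`). Thus a step adds only `O(B ^ 2 * θ ^ 2)`
(`sum_phaseSq_step_le`), and by Gronwall `T / τ` steps add `O(B ^ 2 * τ)`. Dividing by `N` gives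
`O(τ / (p - 1))` for the mean square error per particle.

The fluctuation estimate (`sum_norm_sub_sq_le`) rests on relabelling invariance, which determines
the first two moments of the batch weights. The same invariance, with exchangeable initial data,
makes all particles have equal mean square error (`lintegral_comp_symmetry`). Uniqueness for
Lipschitz equations expresses both solutions as functions of initial datum and divisions, which
supplies measurability and independence. The initial data need no moments: the bound is proved for
each deterministic datum, then integrated. -/

/-! ### Global flows of Lipschitz vector fields -/

section Flow

open Filter Topology

variable {E : Type*} [NormedAddCommGroup E] [NormedSpace ℝ E]

/-- `z` is, on `[0, S]`, a continuous curve whose right derivative is given by the vector field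
`G`. -/
structure IsTrajectory (G : E → E) (S : ℝ) (z : ℝ → E) : Prop where
  cont : ContinuousOn z (Icc 0 S)
  deriv : ∀ t ∈ Ico 0 S, HasDerivWithinAt z (G (z t)) (Ici t) t

namespace IsTrajectory

variable {G : E → E} {S : ℝ} {z w : ℝ → E} {L : NNReal}

theorem mono (h : IsTrajectory G S z) {S' : ℝ} (hS : S' ≤ S) : IsTrajectory G S' z :=
  ⟨h.cont.mono (Icc_subset_Icc_right hS), fun t ht => h.deriv t ⟨ht.1, ht.2.trans_le hS⟩⟩

theorem dist_le (hG : LipschitzWith L G) (hz : IsTrajectory G S z) (hw : IsTrajectory G S w) :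
    ∀ t ∈ Icc 0 S, dist (z t) (w t) ≤ dist (z 0) (w 0) * Real.exp (L * t) := by
  have := dist_le_of_trajectories_ODE (v := fun _ => G) (fun _ => hG) hz.cont hz.deriv
    hw.cont hw.deriv le_rfl
  simpa using this

theorem eqOn (hG : LipschitzWith L G) (hz : IsTrajectory G S z) (hw : IsTrajectory G S w)
    (h0 : z 0 = w 0) : EqOn z w (Icc 0 S) :=
  ODE_solution_unique (v := fun _ => G) (fun _ => hG) hz.cont hz.deriv hw.cont hw.deriv h0

/-- Only right derivatives are required, so at the junction the second piece alone matters; no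
matching of derivatives is needed. -/
theorem append {S' : ℝ} (hS : 0 ≤ S) (hS' : 0 ≤ S') (hz : IsTrajectory G S z)
    (hw : IsTrajectory G S' w) (hzw : z S = w 0) :
    IsTrajectory G (S + S') (fun t => if t ≤ S then z t else w (t - S)) where
  cont := by
    have h1 : ContinuousOn (fun t => w (t - S)) (Icc S (S + S')) :=
      hw.cont.comp (by fun_prop) fun t ht => ⟨by linarith [ht.1], by linarith [ht.2]⟩
    rw [← Icc_union_Icc_eq_Icc hS (by linarith : S ≤ S + S')]
    refine ContinuousOn.union_of_isClosed ?_ ?_ isClosed_Icc isClosed_Icc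
    · exact hz.cont.congr fun t ht => if_pos ht.2
    · refine h1.congr fun t ht => ?_
      rcases ht.1.eq_or_lt with rfl | h
      · simp [hzw]
      · exact if_neg (not_le.2 h)
  deriv t ht := by
    rcases lt_or_ge t S with h | h
    · simp only [h.le, if_true]
      refine (hz.deriv t ⟨ht.1, h⟩).congr_of_eventuallyEq ?_ (by simp [h.le])
      filter_upwards [Icc_mem_nhdsGE h] with s hs using if_pos hs.2
    · have h1 := hw.deriv (t - S) ⟨by linarith, by linarith [ht.2]⟩
      have h2 : HasDerivWithinAt (fun t => t - S) 1 (Ici t) t :=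
        ((hasDerivAt_id t).sub_const S).hasDerivWithinAt
      have h3 : HasDerivWithinAt (fun t => w (t - S)) (G (w (t - S))) (Ici t) t := by
        simpa [Function.comp_def] using
          h1.scomp t h2 (fun s hs => by simpa using hs)
      have h4 : ∀ s ∈ Ici t, (if s ≤ S then z s else w (s - S)) = w (s - S) := by
        intro s hs
        rcases (h.trans hs).eq_or_lt with rfl | h'
        · simp [hzw]
        · exact if_neg (not_le.2 h')
      rw [h4 t self_mem_Ici]
      exact h3.congr h4 (h4 t self_mem_Ici)

theorem exists_of_mul_le [CompleteSpace E] (hG : LipschitzWith L G) {h : ℝ} (h0 : 0 ≤ h)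
    (hL : h * L ≤ 1 / 2) (z₀ : E) : ∃ z : ℝ → E, z 0 = z₀ ∧ IsTrajectory G h z := by
  -- On the ball of radius `a` the field is at most `‖G z₀‖ + L * a`; with `h * L ≤ 1 / 2`, a curve
  -- of that speed moves at most `2 * h * ‖G z₀‖ = a` in time `h`.
  set a : NNReal := ⟨2 * h * ‖G z₀‖, by positivity⟩ with ha
  have hP : IsPicardLindelof (fun _ => G) (tmin := 0) (tmax := h) ⟨0, le_rfl, h0⟩ z₀ a 0
      (‖G z₀‖₊ + L * a) L := by
    refine IsPicardLindelof.of_time_independent (fun x hx => ?_) hG.lipschitzOnWith ?_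
    · have h1 := hG.dist_le_mul x z₀
      have h2 : dist x z₀ ≤ a := hx
      rw [dist_eq_norm] at h1
      calc ‖G x‖ = ‖G z₀ + (G x - G z₀)‖ := by abel_nf
        _ ≤ ‖G z₀‖ + ‖G x - G z₀‖ := norm_add_le _ _
        _ ≤ ‖G z₀‖ + L * a := by gcongr; exact h1.trans (by gcongr)
        _ = _ := by simp
    · have : (a : ℝ) = 2 * h * ‖G z₀‖ := rfl
      have hm : max h 0 = h := max_eq_left h0
      simp [hm]
      rw [this]
      nlinarith [mul_nonneg h0 (norm_nonneg (G z₀))]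
  obtain ⟨z, hz0, hz⟩ := hP.exists_eq_forall_mem_Icc_hasDerivWithinAt₀
  exact ⟨z, hz0, fun t ht => (hz t ht).continuousWithinAt, fun t ht =>
    (hz t ⟨ht.1, ht.2.le⟩).mono_of_mem_nhdsWithin
      (mem_of_superset (Icc_mem_nhdsGE ht.2) (Icc_subset_Icc_left ht.1))⟩

theorem exists_global [CompleteSpace E] (hG : LipschitzWith L G) (hS : 0 ≤ S) (z₀ : E) :
    ∃ z : ℝ → E, z 0 = z₀ ∧ IsTrajectory G S z := by
  obtain ⟨n, hn⟩ := exists_nat_ge (2 * S * L)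
  -- The admissible step length depends on `L` only and not on the starting point, so finitely many
  -- equal steps cover `[0, S]`.
  set h : ℝ := S / (n + 1) with hh
  have h0 : 0 ≤ h := by positivity
  have hL : h * L ≤ 1 / 2 := by
    rw [hh, div_mul_eq_mul_div, div_le_div_iff₀ (by positivity) (by norm_num)]
    nlinarith
  have key : ∀ k : ℕ, ∃ z : ℝ → E, z 0 = z₀ ∧ IsTrajectory G (k * h) z := by
    intro k
    induction k with
    | zero =>
      refine ⟨fun _ => z₀, rfl, continuousOn_const, fun t ht => ?_⟩
      simp only [Nat.cast_zero, zero_mul, Ico_self, mem_empty_iff_false] at ht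
    | succ k ih =>
      obtain ⟨z, hz0, hz⟩ := ih
      obtain ⟨w, hw0, hw⟩ := exists_of_mul_le hG h0 hL (z (k * h))
      refine ⟨_, ?_, (hz.append (by positivity) h0 hw hw0.symm).mono (le_of_eq ?_)⟩
      · simp [hz0, mul_nonneg, h0]
      · push_cast; ring
  obtain ⟨z, hz0, hz⟩ := key (n + 1)
  refine ⟨z, hz0, hz.mono (le_of_eq ?_)⟩
  rw [hh]; push_cast; field_simp

end IsTrajectory

/-- The flow of a vector field on `[0, S]`: the trajectory issued from a given point, if any. -/
noncomputable def flow (G : E → E) (S : ℝ) (t : ℝ) (z₀ : E) : E :=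
  open Classical in
  if h : ∃ z : ℝ → E, z 0 = z₀ ∧ IsTrajectory G S z then h.choose t else z₀

section

variable [CompleteSpace E] {G : E → E} {S : ℝ} {L : NNReal}

theorem flow_zero (hG : LipschitzWith L G) (hS : 0 ≤ S) (z₀ : E) : flow G S 0 z₀ = z₀ := by
  have h := IsTrajectory.exists_global hG hS z₀
  rw [flow, dif_pos h]
  exact h.choose_spec.1

theorem isTrajectory_flow (hG : LipschitzWith L G) (hS : 0 ≤ S) (z₀ : E) :
    IsTrajectory G S (fun t => flow G S t z₀) := by
  have h := IsTrajectory.exists_global hG hS z₀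
  simp only [flow, dif_pos h]
  exact h.choose_spec.2

theorem IsTrajectory.eq_flow (hG : LipschitzWith L G) {S' : ℝ} (hS : S' ≤ S) {z : ℝ → E}
    (hz : IsTrajectory G S' z) {t : ℝ} (ht : t ∈ Icc 0 S') : z t = flow G S t (z 0) := by
  have hS0 : 0 ≤ S := ht.1.trans (ht.2.trans hS)
  exact hz.eqOn hG ((isTrajectory_flow hG hS0 (z 0)).mono hS) (flow_zero hG hS0 _).symm ht

theorem continuous_flow (hG : LipschitzWith L G) {t : ℝ} (ht : t ∈ Icc 0 S) :
    Continuous (flow G S t) := by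
  have hS : 0 ≤ S := ht.1.trans ht.2
  refine (LipschitzWith.of_dist_le_mul (K := ⟨Real.exp (L * t), (Real.exp_pos _).le⟩)
    fun x y => ?_).continuous
  have := (isTrajectory_flow hG hS x).dist_le hG (isTrajectory_flow hG hS y) t ht
  rwa [flow_zero hG hS, flow_zero hG hS, mul_comm] at this

/-- A continuous linear map that intertwines two vector fields intertwines their flows. -/
theorem map_flow {G' : E → E} (hG : LipschitzWith L G) (hG' : LipschitzWith L G')
    (R : E →L[ℝ] E) (hR : ∀ z, G' (R z) = R (G z)) {t : ℝ} (ht : t ∈ Icc 0 S) (z₀ : E) :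
    R (flow G S t z₀) = flow G' S t (R z₀) := by
  have hS : 0 ≤ S := ht.1.trans ht.2
  have h := isTrajectory_flow hG hS z₀
  have h' : IsTrajectory G' S (fun t => R (flow G S t z₀)) :=
    ⟨R.continuous.comp_continuousOn h.cont, fun t ht => by
      rw [hR]; exact R.hasFDerivAt.comp_hasDerivWithinAt t (h.deriv t ht)⟩
  have := h'.eq_flow hG' le_rfl ht
  simpa [flow_zero hG hS] using this

end

end Flow

/-! ### The error of one time step -/

/-- Gronwall, in a form linear in `k * t`: the factor `exp (-(K * t))` turns the inequality into a
derivative at most `k`. This form needs no division by `K` and lets the contributions of successive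
steps add up. -/
theorem le_exp_mul_of_deriv_right_le {u u' : ℝ → ℝ} {K k S : ℝ} (hK : 0 ≤ K) (hk : 0 ≤ k)
    (hu : ContinuousOn u (Icc 0 S)) (hu' : ∀ t ∈ Ico 0 S, HasDerivWithinAt u (u' t) (Ici t) t)
    (hb : ∀ t ∈ Ico 0 S, u' t ≤ K * u t + k) :
    ∀ t ∈ Icc 0 S, u t ≤ Real.exp (K * t) * (u 0 + k * t) := by
  have hd : ∀ t, HasDerivAt (fun t => Real.exp (-(K * t))) (Real.exp (-(K * t)) * -(K * 1)) t :=
    fun t => (((hasDerivAt_id t).const_mul K).neg).exp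
  have key : ∀ ⦃t⦄, t ∈ Icc 0 S → u t * Real.exp (-(K * t)) ≤ u 0 + k * t := by
    refine image_le_of_deriv_right_le_deriv_boundary (hu.mul (by fun_prop))
      (fun t ht => (hu' t ht).mul (hd t).hasDerivWithinAt) (B' := fun _ => k) (by simp)
      (by fun_prop) (fun t ht => ?_) fun t ht => ?_
    · simpa using (((hasDerivAt_id t).const_mul k).const_add (u 0)).hasDerivWithinAt (s := Ici t)
    · have h1 : Real.exp (-(K * t)) ≤ 1 := Real.exp_le_one_iff.2 (by nlinarith [ht.1])
      have h2 := Real.exp_pos (-(K * t))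
      nlinarith [hb t ht]
  intro t ht
  have h := mul_le_mul_of_nonneg_left (key ht) (Real.exp_pos (K * t)).le
  rwa [mul_left_comm, ← Real.exp_add, add_neg_cancel, Real.exp_zero, mul_one] at h

section OneStep

variable {H : Type*} [NormedAddCommGroup H]

open scoped RealInnerProductSpace

/-- The vector field on phase space of the equation `ẍ = f(x)`. -/
def secondOrder (f : H → H) (z : H × H) : H × H := (z.2, f z.1)

/-- The product carries the maximum norm. This constant serves existence, uniqueness and continuity
of flows only; the error estimates use `phaseSq` and the constant `L` of the force. -/
theorem LipschitzWith.secondOrder {f : H → H} {L : NNReal} (hf : LipschitzWith L f) :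
    LipschitzWith (max 1 (L * 1)) (secondOrder f) :=
  LipschitzWith.prod_snd.prodMk (hf.comp LipschitzWith.prod_fst)

/-- The squared Euclidean norm on phase space. -/
def phaseSq (z : H × H) : ℝ := ‖z.1‖ ^ 2 + ‖z.2‖ ^ 2

theorem phaseSq_nonneg (z : H × H) : 0 ≤ phaseSq z := by unfold phaseSq; positivity

theorem continuous_phaseSq : Continuous (phaseSq (H := H)) := by unfold phaseSq; fun_prop

variable [InnerProductSpace ℝ H]

theorem hasDerivWithinAt_phaseSq_sub {f g : H → H} {S : ℝ} {z w : ℝ → H × H}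
    (hz : IsTrajectory (secondOrder f) S z) (hw : IsTrajectory (secondOrder g) S w) {t : ℝ}
    (ht : t ∈ Ico 0 S) :
    HasDerivWithinAt (fun t => phaseSq (z t - w t))
      (2 * ⟪(z t - w t).1, (z t - w t).2⟫ + 2 * ⟪(z t - w t).2, f (z t).1 - g (w t).1⟫)
      (Ici t) t := by
  have h := (hz.deriv t ht).sub (hw.deriv t ht)
  have h1 := (hasFDerivAt_fst (𝕜 := ℝ) (p := z t - w t)).comp_hasDerivWithinAt t h
  have h2 := (hasFDerivAt_snd (𝕜 := ℝ) (p := z t - w t)).comp_hasDerivWithinAt t h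
  exact h1.norm_sq.add h2.norm_sq

theorem two_inner_le {x y : H} {θ : ℝ} (hθ : 0 < θ) :
    2 * ⟪x, y⟫ ≤ θ⁻¹ * ‖x‖ ^ 2 + θ * ‖y‖ ^ 2 := by
  have h := real_inner_le_norm x y
  have h1 : θ⁻¹ * ‖x‖ ^ 2 + θ * ‖y‖ ^ 2 - 2 * (‖x‖ * ‖y‖) = θ⁻¹ * (‖x‖ - θ * ‖y‖) ^ 2 := by
    field_simp; ring
  have h2 : 0 ≤ θ⁻¹ * (‖x‖ - θ * ‖y‖) ^ 2 := by positivity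
  linarith

theorem two_inner_le_of_lipschitz {f : H → H} {L : NNReal} (hf : LipschitzWith L f) (v x y : H) :
    2 * ⟪v, f x - f y⟫ ≤ ‖v‖ ^ 2 + L ^ 2 * ‖x - y‖ ^ 2 := by
  have h := two_inner_le (x := v) (y := f x - f y) one_pos
  have h1 := hf.norm_sub_le x y
  have h2 : ‖f x - f y‖ ^ 2 ≤ (L * ‖x - y‖) ^ 2 := by gcongr
  rw [mul_pow] at h2
  linarith

variable {ι : Type*} [Fintype ι] {f : H → H} {g : ι → H → H} {L : NNReal} {B θ : ℝ}

/-- Starting from the same point, the flows of the random forces `g π` and of `f` are, after a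
time of order `θ`, at a mean square distance of order `θ B`, where `B` is the root mean square of
`g π - f`. -/
theorem sum_phaseSq_le_of_eq (hg : ∀ π, LipschitzWith L (g π))
    (hB : ∀ x, ∑ π, ‖g π x - f x‖ ^ 2 ≤ Fintype.card ι * B ^ 2) (hθ : 0 < θ)
    {y : ℝ → H × H} {q : ι → ℝ → H × H} (hy : IsTrajectory (secondOrder f) θ y)
    (hq : ∀ π, IsTrajectory (secondOrder (g π)) θ (q π)) (h0 : ∀ π, q π 0 = y 0) :
    ∀ t ∈ Icc 0 θ, ∑ π, phaseSq (q π t - y t) ≤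
      Real.exp ((2 + L ^ 2) * θ + 1) * θ ^ 2 * (Fintype.card ι * B ^ 2) := by
  intro t ht
  set M : ℝ := Fintype.card ι * B ^ 2 with hM
  have hM0 : 0 ≤ M := by positivity
  have h := le_exp_mul_of_deriv_right_le (K := 2 + L ^ 2 + θ⁻¹) (k := θ * M)
    (u := fun t => ∑ π, phaseSq (q π t - y t)) (S := θ) (by positivity) (by positivity)
    (continuousOn_finsetSum _ fun π _ =>
      continuous_phaseSq.comp_continuousOn ((hq π).cont.sub hy.cont))
    (fun t ht => HasDerivWithinAt.fun_sum fun π _ =>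
      hasDerivWithinAt_phaseSq_sub (hq π) hy ht) ?_ t ht
  · refine h.trans ?_
    have h1 : ∑ π, phaseSq (q π 0 - y 0) = 0 := by simp [h0, phaseSq]
    rw [h1, zero_add]
    -- The rate contains `θ⁻¹`, but over a time at most `θ` this contributes at most `1` to the
    -- exponent.
    have h2 : (2 + (L : ℝ) ^ 2 + θ⁻¹) * t ≤ (2 + L ^ 2) * θ + 1 := by
      have : (2 + (L : ℝ) ^ 2 + θ⁻¹) * θ = (2 + L ^ 2) * θ + 1 := by field_simp
      rw [← this]
      exact mul_le_mul_of_nonneg_left ht.2 (by positivity)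
    have h3 : θ * M * t ≤ θ ^ 2 * M := by
      have := mul_le_mul_of_nonneg_left ht.2 (mul_nonneg hθ.le hM0)
      linarith
    have := ht.1
    refine (mul_le_mul (Real.exp_le_exp.2 h2) h3 (by positivity) (Real.exp_pos _).le).trans_eq ?_
    ring
  · intro t ht
    have hb : ∀ π, 2 * ⟪(q π t - y t).1, (q π t - y t).2⟫ +
        2 * ⟪(q π t - y t).2, g π (q π t).1 - f (y t).1⟫ ≤
        (2 + L ^ 2 + θ⁻¹) * phaseSq (q π t - y t) + θ * ‖g π (y t).1 - f (y t).1‖ ^ 2 := by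
      intro π
      set e := q π t - y t with he
      have h1 := two_inner_le (x := e.1) (y := e.2) one_pos
      have h2 := two_inner_le_of_lipschitz (hg π) e.2 (q π t).1 (y t).1
      -- The weight `θ` in Young's inequality leaves `θ * B ^ 2` as source, which integrates to
      -- order `θ ^ 2 * B ^ 2` over the step.
      have h3 := two_inner_le (x := e.2) (y := g π (y t).1 - f (y t).1) hθ
      have h4 : g π (q π t).1 - f (y t).1 =
        (g π (q π t).1 - g π (y t).1) + (g π (y t).1 - f (y t).1) := by abel
      have h5 : (q π t).1 - (y t).1 = e.1 := rfl
      rw [h4, inner_add_right]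
      rw [h5] at h2
      have h6 : 0 ≤ θ⁻¹ * ‖e.1‖ ^ 2 := by positivity
      have h7 : 0 ≤ (L : ℝ) ^ 2 * ‖e.2‖ ^ 2 := by positivity
      have h8 := sq_nonneg ‖e.1‖
      unfold phaseSq
      linarith
    calc _ ≤ ∑ π, ((2 + L ^ 2 + θ⁻¹) * phaseSq (q π t - y t) +
          θ * ‖g π (y t).1 - f (y t).1‖ ^ 2) := Finset.sum_le_sum fun π _ => hb π
      _ = (2 + L ^ 2 + θ⁻¹) * ∑ π, phaseSq (q π t - y t) +
          θ * ∑ π, ‖g π (y t).1 - f (y t).1‖ ^ 2 := by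
        rw [Finset.sum_add_distrib, Finset.mul_sum, Finset.mul_sum]
      _ ≤ _ := by gcongr; exact hB _

/-- The exponential rate at which the error of the random batch method grows. -/
noncomputable def stepRate (L : ℝ) : ℝ := 3 + 2 * L ^ 2

/-- The constant of the error that a step of the random batch method adds. -/
noncomputable def stepConst (L T : ℝ) : ℝ :=
  (3 * L ^ 2 * T + 1) * Real.exp ((2 + L ^ 2) * T + 1) + 1

theorem stepRate_nonneg (L : ℝ) : 0 ≤ stepRate L := by unfold stepRate; positivity

theorem stepConst_pos {L T : ℝ} (hT : 0 ≤ T) : 0 < stepConst L T := by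
  unfold stepConst; positivity

/-- Bounding the fluctuation term by Cauchy–Schwarz alone would add `B ^ 2 * t` without the factor
`θ`, and the sum over all steps would not be small. The mean-zero property gains this factor. -/
theorem sum_phaseSq_step_le [CompleteSpace H] (hf : LipschitzWith L f)
    (hg : ∀ π, LipschitzWith L (g π)) (hmean : ∀ x, ∑ π, (g π x - f x) = 0)
    (hB : ∀ x, ∑ π, ‖g π x - f x‖ ^ 2 ≤ Fintype.card ι * B ^ 2) {T : ℝ} (hθ : 0 < θ) (hθT : θ ≤ T)
    {a : ℝ → H × H} {q : ι → ℝ → H × H} (ha : IsTrajectory (secondOrder f) θ a)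
    (hq : ∀ π, IsTrajectory (secondOrder (g π)) θ (q π)) {z' : H × H} (h0 : ∀ π, q π 0 = z') :
    ∀ t ∈ Icc 0 θ, ∑ π, phaseSq (q π t - a t) ≤
      Fintype.card ι * (Real.exp (stepRate L * t) *
        (phaseSq (z' - a 0) + stepConst L T * B ^ 2 * θ * t)) := by
  intro t ht
  -- The intermediate curve follows the full force from the starting point of the batch curves,
  -- hence is the same for every division.
  obtain ⟨y, hy0, hy⟩ := IsTrajectory.exists_global hf.secondOrder hθ.le z'
  have hE := sum_phaseSq_le_of_eq hg hB hθ hy hq (fun π => (h0 π).trans hy0.symm)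
  set M : ℝ := Fintype.card ι * B ^ 2 with hM
  have hM0 : 0 ≤ M := by positivity
  have hC := (stepConst_pos (L := L) (hθ.le.trans hθT)).le
  have h := le_exp_mul_of_deriv_right_le (K := stepRate L) (k := stepConst L T * θ * M)
    (u := fun t => ∑ π, phaseSq (q π t - a t)) (S := θ) (stepRate_nonneg _) (by positivity)
    (continuousOn_finsetSum _ fun π _ =>
      continuous_phaseSq.comp_continuousOn ((hq π).cont.sub ha.cont))
    (fun t ht => HasDerivWithinAt.fun_sum fun π _ =>
      hasDerivWithinAt_phaseSq_sub (hq π) ha ht) ?_ t ht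
  · refine h.trans (le_of_eq ?_)
    simp only [h0, Finset.sum_const, Finset.card_univ, nsmul_eq_mul, hM]
    ring
  · intro t ht
    have hb : ∀ π, 2 * ⟪(q π t - a t).1, (q π t - a t).2⟫ +
        2 * ⟪(q π t - a t).2, g π (q π t).1 - f (a t).1⟫ ≤
        stepRate L * phaseSq (q π t - a t) + (3 * L ^ 2 + θ⁻¹) * phaseSq (q π t - y t) +
          θ * ‖g π (y t).1 - f (y t).1‖ ^ 2 +
          2 * ⟪(y t - a t).2, g π (y t).1 - f (y t).1⟫ := by
      intro π
      set e := q π t - y t with he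
      set δ := q π t - a t with hδ
      set χ := g π (y t).1 - f (y t).1 with hχ
      have h1 := two_inner_le (x := δ.1) (y := δ.2) one_pos
      have h2 := two_inner_le_of_lipschitz (hg π) δ.2 (q π t).1 (y t).1
      have h3 := two_inner_le_of_lipschitz hf δ.2 (y t).1 (a t).1
      have h4 := two_inner_le (x := e.2) (y := χ) hθ
      have h5 : g π (q π t).1 - f (a t).1 =
        (g π (q π t).1 - g π (y t).1) + χ + (f (y t).1 - f (a t).1) := by rw [hχ]; abel
      have h6 : (q π t).1 - (y t).1 = e.1 := rfl
      have h7 : (y t).1 - (a t).1 = δ.1 - e.1 := by simp [hδ, he]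
      have h8 : δ.2 = e.2 + (y t - a t).2 := by simp [hδ, he]
      have h9 : ⟪δ.2, χ⟫ = ⟪e.2, χ⟫ + ⟪(y t - a t).2, χ⟫ := by rw [h8, inner_add_left]
      have h10 : ‖δ.1 - e.1‖ ^ 2 ≤ 2 * (‖δ.1‖ ^ 2 + ‖e.1‖ ^ 2) := by
        have := parallelogram_law_with_norm ℝ δ.1 e.1
        nlinarith [sq_nonneg ‖δ.1 + e.1‖]
      have h11 := mul_le_mul_of_nonneg_left h10 (sq_nonneg (L : ℝ))
      rw [h6] at h2
      rw [h7] at h3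
      rw [h5, inner_add_right, inner_add_right, h9]
      have h12 : 0 ≤ θ⁻¹ * ‖e.1‖ ^ 2 := by positivity
      have h13 : 0 ≤ (L : ℝ) ^ 2 * ‖e.2‖ ^ 2 := by positivity
      have h14 : 0 ≤ (L : ℝ) ^ 2 * ‖δ.2‖ ^ 2 := by positivity
      have h15 := sq_nonneg ‖δ.1‖
      unfold phaseSq stepRate
      linarith
    calc _ ≤ _ := Finset.sum_le_sum fun π _ => hb π
      _ = stepRate L * ∑ π, phaseSq (q π t - a t) +
          (3 * L ^ 2 + θ⁻¹) * ∑ π, phaseSq (q π t - y t) +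
          θ * ∑ π, ‖g π (y t).1 - f (y t).1‖ ^ 2 := by
        -- The vector paired with the fluctuation does not depend on `π`, so `hmean` removes the
        -- whole sum.
        simp only [Finset.sum_add_distrib, ← Finset.mul_sum, ← inner_sum, hmean, inner_zero_right,
          mul_zero, add_zero]
      _ ≤ stepRate L * ∑ π, phaseSq (q π t - a t) +
          (3 * L ^ 2 + θ⁻¹) * (Real.exp ((2 + L ^ 2) * θ + 1) * θ ^ 2 * M) + θ * M := by
        gcongr
        · exact hE t ⟨ht.1, ht.2.le⟩
        · exact hB _
      _ = stepRate L * ∑ π, phaseSq (q π t - a t) +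
          ((3 * L ^ 2 * θ + 1) * Real.exp ((2 + L ^ 2) * θ + 1) + 1) * θ * M := by
        field_simp; ring
      _ ≤ _ := by 
        have := hθ.trans_le hθT
        unfold stepConst
        gcongr

end OneStep

/-! ### Trajectories whose vector field is redrawn at every time step -/

theorem exists_nat_mul_add_eq {τ : ℝ} (hτ : 0 < τ) {t : ℝ} (ht : 0 ≤ t) :
    ∃ m : ℕ, ∃ s ∈ Icc 0 τ, m * τ + s = t := by
  refine ⟨⌊t / τ⌋₊, t - ⌊t / τ⌋₊ * τ, ⟨?_, ?_⟩, by ring⟩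
  · have := (le_div_iff₀ hτ).1 (Nat.floor_le (div_nonneg ht hτ.le))
    linarith
  · have := (div_lt_iff₀ hτ).1 (Nat.lt_floor_add_one (t / τ))
    linarith

section Split

variable {E : Type*} [NormedAddCommGroup E] [NormedSpace ℝ E] {ι : Type*}

/-- `z` is a continuous curve on `[0, T]` that follows the vector field `G (x m)` during the time
step `[m τ, (m + 1) τ)`. -/
structure IsSplitTrajectory (G : ι → E → E) (τ T : ℝ) (x : ℕ → ι) (z : ℝ → E) : Prop where
  cont : ContinuousOn z (Icc 0 T)
  deriv : ∀ m : ℕ, ∀ t ∈ Ico (m * τ) ((m + 1) * τ), t < T →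
    HasDerivWithinAt z (G (x m) (z t)) (Ici t) t

/-- The state at time `m τ` of the process that follows `G (x m)` during the `m`-th step. -/
noncomputable def splitState (G : ι → E → E) (S τ : ℝ) (x : ℕ → ι) : ℕ → E → E
  | 0, z => z
  | m + 1, z => flow (G (x m)) S τ (splitState G S τ x m z)

/-- The state at time `m τ + t` of the process that follows `G (x m)` during the `m`-th step. -/
noncomputable def splitFlow (G : ι → E → E) (S τ : ℝ) (x : ℕ → ι) (m : ℕ) (t : ℝ) (z : E) : E :=
  flow (G (x m)) S t (splitState G S τ x m z)

/-- The full system is also written step by step, to share formulas with the batch system; its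
division sequence is a dummy argument. -/
theorem splitState_const {G : E → E} {S τ : ℝ} (x x' : ℕ → ι) (m : ℕ) (z : E) :
    splitState (fun _ => G) S τ x m z = splitState (fun _ => G) S τ x' m z := by
  induction m with
  | zero => rfl
  | succ m ih => rw [splitState, splitState, ih]

theorem splitFlow_const {G : E → E} {S τ : ℝ} (x x' : ℕ → ι) (m : ℕ) (t : ℝ) (z : E) :
    splitFlow (fun _ => G) S τ x m t z = splitFlow (fun _ => G) S τ x' m t z := by
  rw [splitFlow, splitFlow, splitState_const x x']

theorem IsTrajectory.isSplitTrajectory {G : E → E} {τ T : ℝ} {z : ℝ → E} (hτ : 0 < τ)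
    (hz : IsTrajectory G T z) (x : ℕ → ι) : IsSplitTrajectory (fun _ => G) τ T x z :=
  ⟨hz.cont, fun m t ht htT => hz.deriv t ⟨le_trans (by positivity) ht.1, htT⟩⟩

variable {G : ι → E → E} {L : NNReal} {S τ T : ℝ}

theorem IsSplitTrajectory.isTrajectory {x : ℕ → ι} {z : ℝ → E} (hτ : 0 < τ)
    (hz : IsSplitTrajectory G τ T x z) (m : ℕ) {s : ℝ} (hs : s ≤ τ) (hsT : m * τ + s ≤ T) :
    IsTrajectory (G (x m)) s (fun t => z (m * τ + t)) where
  cont := hz.cont.comp (by fun_prop) fun t ht =>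
    ⟨add_nonneg (by positivity) ht.1, by linarith [ht.2]⟩
  deriv t ht := by
    have h1 := hz.deriv m (m * τ + t) ⟨by linarith [ht.1], by linarith [ht.2]⟩
      (by linarith [ht.2])
    have h2 : HasDerivWithinAt (fun t => m * τ + t) 1 (Ici t) t :=
      ((hasDerivAt_id t).const_add _).hasDerivWithinAt
    simpa [Function.comp_def] using h1.scomp t h2 (fun s hs => by simpa using hs)

variable [CompleteSpace E]

theorem IsSplitTrajectory.eq_splitFlow {x : ℕ → ι} {z : ℝ → E} (hG : ∀ π, LipschitzWith L (G π))
    (hτ : 0 < τ) (hτS : τ ≤ S) (hz : IsSplitTrajectory G τ T x z) (m : ℕ) {t : ℝ}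
    (ht : t ∈ Icc 0 τ) (htT : m * τ + t ≤ T) :
    z (m * τ + t) = splitFlow G S τ x m t (z 0) := by
  induction m generalizing t with
  | zero =>
    have := (hz.isTrajectory hτ 0 ht.2 htT).eq_flow (hG _) (ht.2.trans hτS) ⟨ht.1, le_rfl⟩
    simpa [splitFlow, splitState] using this
  | succ m ih =>
    have h1 := (hz.isTrajectory hτ (m + 1) ht.2 htT).eq_flow (hG _) (ht.2.trans hτS)
      ⟨ht.1, le_rfl⟩
    have h2 := ih (t := τ) ⟨hτ.le, le_rfl⟩ (by push_cast at htT; linarith [ht.1])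
    have h3 : ((m + 1 : ℕ) : ℝ) * τ + 0 = m * τ + τ := by push_cast; ring
    rw [h1, h3, h2]
    rfl

/-- By uniqueness, arbitrary solutions become explicit functions of the initial datum and the
divisions, with the same step index and elapsed time for both. -/
theorem exists_ae_eq_splitFlow {Ω : Type*} [MeasurableSpace Ω] {P : Measure Ω} {F : E → E}
    (hF : LipschitzWith L F) (hG : ∀ π, LipschitzWith L (G π)) (hτ : 0 < τ) {ξ : ℕ → Ω → ι}
    {z₀ : Ω → E} {Z Z' : Ω → ℝ → E} (hZ : ∀ᵐ ω ∂P, Z ω 0 = z₀ ω ∧ IsTrajectory F T (Z ω))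
    (hZ' : ∀ᵐ ω ∂P, Z' ω 0 = z₀ ω ∧ IsSplitTrajectory G τ T (fun k => ξ k ω) (Z' ω))
    {t : ℝ} (ht : t ∈ Icc 0 T) :
    ∃ m : ℕ, ∃ s ∈ Icc 0 τ, m * τ + s = t ∧
      (∀ᵐ ω ∂P, Z ω t = splitFlow (fun _ => F) τ τ (fun k => ξ k ω) m s (z₀ ω)) ∧
      ∀ᵐ ω ∂P, Z' ω t = splitFlow G τ τ (fun k => ξ k ω) m s (z₀ ω) := by
  obtain ⟨m, s, hs, rfl⟩ := exists_nat_mul_add_eq hτ ht.1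
  refine ⟨m, s, hs, rfl, ?_, ?_⟩
  · filter_upwards [hZ] with ω ⟨h0, h⟩
    rw [← h0]
    exact (h.isSplitTrajectory hτ _).eq_splitFlow (fun _ => hF) hτ le_rfl m hs ht.2
  · filter_upwards [hZ'] with ω ⟨h0, h⟩
    rw [← h0]
    exact h.eq_splitFlow hG hτ le_rfl m hs ht.2

theorem map_splitState (hG : ∀ π, LipschitzWith L (G π)) (hτ : τ ∈ Icc 0 S) (R : E →L[ℝ] E)
    (σ : ι → ι) (hR : ∀ π z, G (σ π) (R z) = R (G π z)) (x : ℕ → ι) (m : ℕ) (z : E) :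
    R (splitState G S τ x m z) = splitState G S τ (fun k => σ (x k)) m (R z) := by
  induction m with
  | zero => rfl
  | succ m ih => rw [splitState, splitState, map_flow (hG _) (hG _) R (hR _) hτ, ih]

theorem map_splitFlow (hG : ∀ π, LipschitzWith L (G π)) (hτ : τ ∈ Icc 0 S) (R : E →L[ℝ] E)
    (σ : ι → ι) (hR : ∀ π z, G (σ π) (R z) = R (G π z)) (x : ℕ → ι) (m : ℕ) {t : ℝ}
    (ht : t ∈ Icc 0 S) (z : E) :
    R (splitFlow G S τ x m t z) = splitFlow G S τ (fun k => σ (x k)) m t (R z) := by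
  rw [splitFlow, map_flow (hG _) (hG _) R (hR _) ht, map_splitState hG hτ R σ hR, splitFlow]

/-! ### Measurability in the initial datum and the divisions -/

variable [MeasurableSpace E] [BorelSpace E] [Countable ι] [MeasurableSpace ι]
  [MeasurableSingletonClass ι]

theorem measurable_flow_comp {Ω : Type*} [MeasurableSpace Ω] (hG : ∀ π, LipschitzWith L (G π))
    {t : ℝ} (ht : t ∈ Icc 0 S) {η : Ω → ι} (hη : Measurable η) {Z : Ω → E} (hZ : Measurable Z) :
    Measurable fun ω => flow (G (η ω)) S t (Z ω) := by
  have : Measurable fun p : ι × E => flow (G p.1) S t p.2 :=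
    measurable_from_prod_countable_right fun π => (continuous_flow (hG π) ht).measurable
  exact this.comp (hη.prodMk hZ)

/-- Only the divisions before step `m` are required to be measurable, so the lemma also applies to
the σ-algebra that they generate. -/
theorem measurable_splitState {Ω : Type*} [MeasurableSpace Ω] (hG : ∀ π, LipschitzWith L (G π))
    (hτ : τ ∈ Icc 0 S) {ξ : ℕ → Ω → ι} {Z : Ω → E} (hZ : Measurable Z) (m : ℕ)
    (hξ : ∀ k < m, Measurable (ξ k)) :
    Measurable fun ω => splitState G S τ (fun k => ξ k ω) m (Z ω) := by
  induction m with
  | zero => exact hZ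
  | succ m ih =>
    exact measurable_flow_comp hG hτ (hξ m m.lt_succ_self)
      (ih fun k hk => hξ k (hk.trans m.lt_succ_self))

theorem measurable_splitFlow {Ω : Type*} [MeasurableSpace Ω] (hG : ∀ π, LipschitzWith L (G π))
    (hτ : τ ∈ Icc 0 S) {ξ : ℕ → Ω → ι} (hξ : ∀ k, Measurable (ξ k)) {Z : Ω → E}
    (hZ : Measurable Z) (m : ℕ) {t : ℝ} (ht : t ∈ Icc 0 S) :
    Measurable fun ω => splitFlow G S τ (fun k => ξ k ω) m t (Z ω) :=
  measurable_flow_comp hG ht (hξ m) (measurable_splitState hG hτ hZ m fun k _ => hξ k)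

theorem aemeasurable_sub_of_isSplitTrajectory [SecondCountableTopology E] {Ω : Type*}
    [MeasurableSpace Ω] {P : Measure Ω} {F : E → E} (hF : LipschitzWith L F)
    (hG : ∀ π, LipschitzWith L (G π)) (hτ : 0 < τ) {ξ : ℕ → Ω → ι}
    (hξ : ∀ k, Measurable (ξ k)) {z₀ : Ω → E} (hz₀ : Measurable z₀) {Z Z' : Ω → ℝ → E}
    (hZ : ∀ᵐ ω ∂P, Z ω 0 = z₀ ω ∧ IsTrajectory F T (Z ω))
    (hZ' : ∀ᵐ ω ∂P, Z' ω 0 = z₀ ω ∧ IsSplitTrajectory G τ T (fun k => ξ k ω) (Z' ω))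
    {t : ℝ} (ht : t ∈ Icc 0 T) : AEMeasurable (fun ω => Z ω t - Z' ω t) P := by
  obtain ⟨m, s, hs, rfl, h, h'⟩ := exists_ae_eq_splitFlow hF hG hτ hZ hZ' ht
  have hτ' : τ ∈ Icc 0 τ := ⟨hτ.le, le_rfl⟩
  exact AEMeasurable.sub ⟨_, measurable_splitFlow (fun _ => hF) hτ' hξ hz₀ m hs, h⟩
    ⟨_, measurable_splitFlow hG hτ' hξ hz₀ m hs, h'⟩

end Split

/-! ### The error of the random batch method -/

section Random

variable {Ω : Type*} [MeasurableSpace Ω] {P : Measure Ω}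
  {ι : Type*} [Fintype ι] [MeasurableSpace ι] [MeasurableSingletonClass ι]

theorem indepFun_splitState {E : Type*} [NormedAddCommGroup E] [NormedSpace ℝ E]
    [CompleteSpace E] [MeasurableSpace E] [BorelSpace E] {L : NNReal} {S τ : ℝ}
    {G : ι → E → E} (hG : ∀ π, LipschitzWith L (G π))
    (hτ : τ ∈ Icc 0 S) {ξ : ℕ → Ω → ι} (hξ : ∀ k, Measurable (ξ k)) (hind : iIndepFun ξ P)
    (z : E) (m : ℕ) :
    IndepFun (fun ω => splitState G S τ (fun k => ξ k ω) m z) (ξ m) P := by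
  have h1 := indep_iSup_of_disjoint (fun k => (hξ k).comap_le)
    ((iIndepFun_iff_iIndep _ _ _).1 hind) (S := Iio m) (T := {m}) (by simp)
  rw [IndepFun_iff_Indep]
  refine indep_of_indep_of_le_left (indep_of_indep_of_le_right h1 ?_) ?_
  · exact le_iSup₂_of_le m rfl le_rfl
  · refine Measurable.comap_le ?_
    -- The ambient σ-algebra is replaced by the one generated by `ξ k`, `k < m`, which is
    -- independent of `ξ m`.
    refine @measurable_splitState _ _ _ _ _ L S τ _ _ _ _ _ _ _
      (⨆ k ∈ Iio m, MeasurableSpace.comap (ξ k) inferInstance) hG hτ ξ (fun _ => z)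
      (@measurable_const _ _ _ _ _) m fun k hk => ?_
    exact (comap_measurable (ξ k)).mono (le_iSup₂_of_le k hk le_rfl) le_rfl

theorem map_equiv_comp_eq_of_uniform {η : Ω → ι} (hη : Measurable η)
    (hunif : ∀ π, P {ω | η ω = π} = (Fintype.card ι : ℝ≥0∞)⁻¹) (σ : ι ≃ ι) :
    P.map (σ ∘ η) = P.map η := by
  refine Measure.ext_of_singleton fun π => ?_
  rw [Measure.map_apply ((measurable_of_countable _).comp hη) (measurableSet_singleton π),
    Measure.map_apply hη (measurableSet_singleton π)]
  have : σ ∘ η ⁻¹' {π} = {ω | η ω = σ.symm π} := by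
    ext ω; simp [Equiv.eq_symm_apply]
  rw [this, hunif]
  exact (hunif π).symm

variable [IsProbabilityMeasure P]

theorem lintegral_eq_lintegral_lintegral_of_indepFun {α β : Type*} [MeasurableSpace α]
    [MeasurableSpace β] {W : Ω → α} {η : Ω → β} (hW : Measurable W) (hη : Measurable η)
    (hind : IndepFun W η P) {φ : α → β → ℝ≥0∞} (hφ : Measurable (Function.uncurry φ)) :
    ∫⁻ ω, φ (W ω) (η ω) ∂P = ∫⁻ ω, ∫⁻ ω', φ (W ω) (η ω') ∂P ∂P := by
  have h1 : ∫⁻ ω, φ (W ω) (η ω) ∂P =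
      ∫⁻ p, Function.uncurry φ p ∂P.map (fun ω => (W ω, η ω)) :=
    (lintegral_map hφ (hW.prodMk hη)).symm
  have : IsProbabilityMeasure (P.map η) := Measure.isProbabilityMeasure_map hη.aemeasurable
  rw [h1, (indepFun_iff_map_prod_eq_prod_map_map hW.aemeasurable hη.aemeasurable).1 hind,
    lintegral_prod _ hφ.aemeasurable, lintegral_map hφ.lintegral_prod_right' hW]
  exact lintegral_congr fun ω => lintegral_map (hφ.comp measurable_prodMk_left) hη

/-- Fubini freezes the state; uniformity then turns the expectation over the division into the
finite average to which the deterministic one-step bound applies. -/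
theorem lintegral_of_uniform {α : Type*} [MeasurableSpace α] {W : Ω → α} {η : Ω → ι}
    (hW : Measurable W) (hη : Measurable η) (hind : IndepFun W η P)
    (hunif : ∀ π, P {ω | η ω = π} = (Fintype.card ι : ℝ≥0∞)⁻¹) {φ : α → ι → ℝ≥0∞}
    (hφ : ∀ π, Measurable fun a => φ a π) :
    ∫⁻ ω, φ (W ω) (η ω) ∂P = ∫⁻ ω, (Fintype.card ι : ℝ≥0∞)⁻¹ * ∑ π, φ (W ω) π ∂P := by
  rw [lintegral_eq_lintegral_lintegral_of_indepFun hW hη hind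
    (measurable_from_prod_countable_left hφ)]
  refine lintegral_congr fun ω => ?_
  rw [← lintegral_map (f := fun π => φ (W ω) π) (measurable_of_countable _) hη, lintegral_fintype,
    Finset.mul_sum]
  refine Finset.sum_congr rfl fun π _ => ?_
  rw [Measure.map_apply hη (measurableSet_singleton π), mul_comm]
  congr 1
  exact hunif π

variable {H : Type*} [NormedAddCommGroup H] [InnerProductSpace ℝ H] [CompleteSpace H]
  [MeasurableSpace H] [BorelSpace H] [SecondCountableTopology H]
  {f : H → H} {g : ι → H → H} {L : NNReal} {B θ T S τ : ℝ}

theorem lintegral_phaseSq_step_le (hf : LipschitzWith L f) (hg : ∀ π, LipschitzWith L (g π))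
    (hmean : ∀ x, ∑ π, (g π x - f x) = 0)
    (hB : ∀ x, ∑ π, ‖g π x - f x‖ ^ 2 ≤ Fintype.card ι * B ^ 2) (hθ : 0 < θ) (hθT : θ ≤ T)
    (hθS : θ ≤ S) {η : Ω → ι} (hη : Measurable η)
    (hunif : ∀ π, P {ω | η ω = π} = (Fintype.card ι : ℝ≥0∞)⁻¹) {W : Ω → H × H}
    (hW : Measurable W) (hind : IndepFun W η P) (a : H × H) {t : ℝ} (ht : t ∈ Icc 0 θ) :
    ∫⁻ ω, ENNReal.ofReal (phaseSq (flow (secondOrder (g (η ω))) S t (W ω) -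
        flow (secondOrder f) S t a)) ∂P ≤
      ENNReal.ofReal (Real.exp (stepRate L * t)) *
        (∫⁻ ω, ENNReal.ofReal (phaseSq (W ω - a)) ∂P +
          ENNReal.ofReal (stepConst L T * B ^ 2 * θ * t)) := by
  have hS : 0 ≤ S := hθ.le.trans hθS
  have htS : t ∈ Icc 0 S := ⟨ht.1, ht.2.trans hθS⟩
  have hm : ∀ π, Measurable fun w : H × H => ENNReal.ofReal
      (phaseSq (flow (secondOrder (g π)) S t w - flow (secondOrder f) S t a)) := fun π =>
    (continuous_phaseSq.comp
      ((continuous_flow (hg π).secondOrder htS).sub continuous_const)).measurable.ennreal_ofReal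
  obtain ⟨ω₀⟩ := P.nonempty_of_neZero
  have hcard : (Fintype.card ι : ℝ≥0∞) ≠ 0 := by
    have : Nonempty ι := ⟨η ω₀⟩
    exact_mod_cast Fintype.card_ne_zero
  have hC := stepConst_pos (L := L) (hθ.le.trans hθT)
  rw [lintegral_of_uniform hW hη hind hunif
    (φ := fun w π => ENNReal.ofReal
      (phaseSq (flow (secondOrder (g π)) S t w - flow (secondOrder f) S t a))) hm]
  have hpt : ∀ w : H × H, (Fintype.card ι : ℝ≥0∞)⁻¹ * ∑ π, ENNReal.ofReal
      (phaseSq (flow (secondOrder (g π)) S t w - flow (secondOrder f) S t a)) ≤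
      ENNReal.ofReal (Real.exp (stepRate L * t)) * (ENNReal.ofReal (phaseSq (w - a)) +
          ENNReal.ofReal (stepConst L T * B ^ 2 * θ * t)) := by
    intro w
    have h := sum_phaseSq_step_le hf hg hmean hB hθ hθT
      ((isTrajectory_flow hf.secondOrder hS a).mono hθS)
      (fun π => (isTrajectory_flow (hg π).secondOrder hS w).mono hθS)
      (fun π => flow_zero (hg π).secondOrder hS w) t ht
    rw [flow_zero hf.secondOrder hS] at h
    rw [← ENNReal.ofReal_sum_of_nonneg fun π _ => phaseSq_nonneg _]
    refine (mul_le_mul_right (ENNReal.ofReal_le_ofReal h) _).trans (le_of_eq ?_)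
    rw [ENNReal.ofReal_mul (by positivity), ENNReal.ofReal_natCast, ← mul_assoc,
      ENNReal.inv_mul_cancel hcard (ENNReal.natCast_ne_top _), one_mul,
      ENNReal.ofReal_mul (Real.exp_pos _).le, ENNReal.ofReal_add (phaseSq_nonneg _)
        (by have := ht.1; positivity)]
  refine (lintegral_mono fun ω => hpt (W ω)).trans (le_of_eq ?_)
  have hmW : Measurable fun ω => ENNReal.ofReal (phaseSq (W ω - a)) :=
    (continuous_phaseSq.measurable.comp (hW.sub_const a)).ennreal_ofReal
  rw [lintegral_const_mul _ (hmW.add_const _), lintegral_add_right _ measurable_const]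
  simp

theorem lintegral_phaseSq_splitState_le (hf : LipschitzWith L f)
    (hg : ∀ π, LipschitzWith L (g π)) (hmean : ∀ x, ∑ π, (g π x - f x) = 0)
    (hB : ∀ x, ∑ π, ‖g π x - f x‖ ^ 2 ≤ Fintype.card ι * B ^ 2) (hT : 0 < T) (hτ : 0 < τ)
    (hτS : τ ≤ S) {ξ : ℕ → Ω → ι} (hξ : ∀ k, Measurable (ξ k))
    (hunif : ∀ k π, P {ω | ξ k ω = π} = (Fintype.card ι : ℝ≥0∞)⁻¹) (hind : iIndepFun ξ P)
    (z : H × H) (x : ℕ → ι) (m : ℕ) (hm : m * τ ≤ T) :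
    ∫⁻ ω, ENNReal.ofReal (phaseSq
        (splitState (fun π => secondOrder (g π)) S τ (fun k => ξ k ω) m z -
          splitState (fun _ => secondOrder f) S τ x m z)) ∂P ≤
      ENNReal.ofReal (Real.exp (stepRate L * (m * τ)) *
        (stepConst L T * B ^ 2 * min τ T * (m * τ))) := by
  have hC := stepConst_pos (L := L) hT.le
  induction m with
  | zero => simp [splitState, phaseSq]
  | succ m ih =>
    push_cast at hm
    -- A completed step fits into `[0, T]`, so the minimum is `τ`.
    have hτT : τ ≤ T := by nlinarith [mul_nonneg m.cast_nonneg hτ.le]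
    have h := lintegral_phaseSq_step_le hf hg hmean hB hτ hτT hτS (hξ m) (hunif m)
      (measurable_splitState (fun π => (hg π).secondOrder) ⟨hτ.le, hτS⟩
        (measurable_const (a := z)) m fun k _ => hξ k)
      (indepFun_splitState (fun π => (hg π).secondOrder) ⟨hτ.le, hτS⟩ hξ hind z m)
      (splitState (fun _ => secondOrder f) S τ x m z) (t := τ) ⟨hτ.le, le_rfl⟩
    refine h.trans ((mul_le_mul_right (add_le_add_left (ih (by linarith)) _) _).trans ?_)
    rw [min_eq_left hτT]
    set A := stepConst L T * B ^ 2 * τ with hA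
    have hA0 : 0 ≤ A := by positivity
    rw [← ENNReal.ofReal_add (by positivity) (by positivity),
      ← ENNReal.ofReal_mul (Real.exp_pos _).le]
    refine ENNReal.ofReal_le_ofReal ?_
    -- The new increment is enlarged by the old exponential, so that both terms share one factor and
    -- the bound keeps its shape.
    have h1 : 1 ≤ Real.exp (stepRate L * (m * τ)) :=
      Real.one_le_exp (mul_nonneg (stepRate_nonneg _) (by positivity))
    have h2 : Real.exp (stepRate L * ((m + 1 : ℕ) * τ)) =
        Real.exp (stepRate L * τ) * Real.exp (stepRate L * (m * τ)) := by
      rw [← Real.exp_add]; push_cast; ring_nf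
    rw [h2]
    refine (mul_le_mul_of_nonneg_left ?_ (Real.exp_pos _).le).trans_eq (mul_assoc _ _ _).symm
    have h3 : A * τ ≤ Real.exp (stepRate L * (m * τ)) * (A * τ) :=
      le_mul_of_one_le_left (by positivity) h1
    push_cast
    linarith

/-- The mean square error at time `m τ + t` for deterministic initial data. -/
theorem lintegral_phaseSq_splitFlow_le (hf : LipschitzWith L f)
    (hg : ∀ π, LipschitzWith L (g π)) (hmean : ∀ x, ∑ π, (g π x - f x) = 0)
    (hB : ∀ x, ∑ π, ‖g π x - f x‖ ^ 2 ≤ Fintype.card ι * B ^ 2) (hT : 0 < T) (hτ : 0 < τ)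
    (hτS : τ ≤ S) {ξ : ℕ → Ω → ι} (hξ : ∀ k, Measurable (ξ k))
    (hunif : ∀ k π, P {ω | ξ k ω = π} = (Fintype.card ι : ℝ≥0∞)⁻¹) (hind : iIndepFun ξ P)
    (z : H × H) (x : ℕ → ι) (m : ℕ) {t : ℝ} (ht : t ∈ Icc 0 τ) (htT : m * τ + t ≤ T) :
    ∫⁻ ω, ENNReal.ofReal (phaseSq
        (splitFlow (fun π => secondOrder (g π)) S τ (fun k => ξ k ω) m t z -
          splitFlow (fun _ => secondOrder f) S τ x m t z)) ∂P ≤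
      ENNReal.ofReal (Real.exp (stepRate L * T) * (stepConst L T * T) * B ^ 2 * τ) := by
  have hC := stepConst_pos (L := L) hT.le
  have hmτ : 0 ≤ m * τ := by positivity
  -- The current step may outlast `T`, already for `m = 0`; length `min τ T` keeps the one-step
  -- constant dependent on `T` only.
  have h := lintegral_phaseSq_step_le hf hg hmean hB (lt_min hτ hT) (min_le_right τ T)
    ((min_le_left τ T).trans hτS) (hξ m) (hunif m)
    (measurable_splitState (fun π => (hg π).secondOrder) ⟨hτ.le, hτS⟩
      (measurable_const (a := z)) m fun k _ => hξ k)
    (indepFun_splitState (fun π => (hg π).secondOrder) ⟨hτ.le, hτS⟩ hξ hind z m)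
    (splitState (fun _ => secondOrder f) S τ x m z) (t := t)
    ⟨ht.1, le_min ht.2 (by linarith)⟩
  have h0 := lintegral_phaseSq_splitState_le hf hg hmean hB hT hτ hτS hξ hunif hind z x m
    (by linarith [ht.1])
  refine h.trans ((mul_le_mul_right (add_le_add_left h0 _) _).trans ?_)
  set A := stepConst L T * B ^ 2 * min τ T with hA
  have hA0 : 0 ≤ A := by have := lt_min hτ hT; positivity
  have ht0 := ht.1
  rw [← ENNReal.ofReal_add (by positivity) (by positivity),
    ← ENNReal.ofReal_mul (Real.exp_pos _).le]
  refine ENNReal.ofReal_le_ofReal ?_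
  have h1 : 1 ≤ Real.exp (stepRate L * (m * τ)) :=
    Real.one_le_exp (mul_nonneg (stepRate_nonneg _) (by positivity))
  have h3 : A * t ≤ Real.exp (stepRate L * (m * τ)) * (A * t) :=
    le_mul_of_one_le_left (by positivity) h1
  have hAτ : A ≤ stepConst L T * B ^ 2 * τ := by rw [hA]; gcongr; exact min_le_left _ _
  calc _ ≤ Real.exp (stepRate L * t) * (Real.exp (stepRate L * (m * τ)) * (A * (m * τ + t))) := by
        gcongr; linarith
    _ = Real.exp (stepRate L * (m * τ + t)) * (A * (m * τ + t)) := by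
        rw [← mul_assoc, ← Real.exp_add]; ring_nf
    _ ≤ Real.exp (stepRate L * T) * ((stepConst L T * B ^ 2 * τ) * T) := by
        have := stepRate_nonneg L
        gcongr
    _ = _ := by ring

/-- The mean square error at time `t` for random initial data. -/
theorem lintegral_phaseSq_sub_le (hf : LipschitzWith L f) (hg : ∀ π, LipschitzWith L (g π))
    (hmean : ∀ x, ∑ π, (g π x - f x) = 0)
    (hB : ∀ x, ∑ π, ‖g π x - f x‖ ^ 2 ≤ Fintype.card ι * B ^ 2) (hT : 0 < T) (hτ : 0 < τ)
    {ξ : ℕ → Ω → ι} (hξ : ∀ k, Measurable (ξ k))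
    (hunif : ∀ k π, P {ω | ξ k ω = π} = (Fintype.card ι : ℝ≥0∞)⁻¹) (hind : iIndepFun ξ P)
    {z₀ : Ω → H × H} (hz₀ : Measurable z₀) (hind₀ : IndepFun z₀ (fun ω k => ξ k ω) P)
    {Z Z' : Ω → ℝ → H × H}
    (hZ : ∀ᵐ ω ∂P, Z ω 0 = z₀ ω ∧ IsTrajectory (secondOrder f) T (Z ω))
    (hZ' : ∀ᵐ ω ∂P, Z' ω 0 = z₀ ω ∧
      IsSplitTrajectory (fun π => secondOrder (g π)) τ T (fun k => ξ k ω) (Z' ω))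
    {t : ℝ} (ht : t ∈ Icc 0 T) :
    ∫⁻ ω, ENNReal.ofReal (phaseSq (Z' ω t - Z ω t)) ∂P ≤
      ENNReal.ofReal (Real.exp (stepRate L * T) * (stepConst L T * T) * B ^ 2 * τ) := by
  obtain ⟨m, s, hs, rfl, h, h'⟩ :=
    exists_ae_eq_splitFlow hf.secondOrder (fun π => (hg π).secondOrder) hτ hZ hZ' ht
  have hτ' : τ ∈ Icc 0 τ := ⟨hτ.le, le_rfl⟩
  have hx : ∀ k, Measurable fun p : (H × H) × (ℕ → ι) => p.2 k := fun k =>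
    (measurable_pi_apply k).comp measurable_snd
  obtain ⟨ω₀⟩ := P.nonempty_of_neZero
  have hm : Measurable (Function.uncurry fun (z : H × H) (x : ℕ → ι) => ENNReal.ofReal (phaseSq
      (splitFlow (fun π => secondOrder (g π)) τ τ x m s z -
        splitFlow (fun _ => secondOrder f) τ τ x m s z))) :=
    (continuous_phaseSq.measurable.comp
      ((measurable_splitFlow (fun π => (hg π).secondOrder) hτ' hx measurable_fst m hs).sub
      (measurable_splitFlow (fun _ => hf.secondOrder) hτ' hx measurable_fst m hs))).ennreal_ofReal
  calc _ = ∫⁻ ω, ENNReal.ofReal (phaseSq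
        (splitFlow (fun π => secondOrder (g π)) τ τ (fun k => ξ k ω) m s (z₀ ω) -
          splitFlow (fun _ => secondOrder f) τ τ (fun k => ξ k ω) m s (z₀ ω))) ∂P := by
        refine lintegral_congr_ae ?_
        filter_upwards [h, h'] with ω h1 h2
        rw [h1, h2]
    _ = _ := lintegral_eq_lintegral_lintegral_of_indepFun hz₀ (measurable_pi_iff.2 hξ) hind₀ hm
    _ ≤ ∫⁻ _, ENNReal.ofReal
          (Real.exp (stepRate L * T) * (stepConst L T * T) * B ^ 2 * τ) ∂P := by
        refine lintegral_mono fun ω => ?_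
        have h0 := lintegral_phaseSq_splitFlow_le hf hg hmean hB hT hτ le_rfl hξ hunif hind (z₀ ω)
          (fun k => ξ k ω₀) m hs ht.2
        refine (lintegral_congr fun ω' => ?_).trans_le h0
        -- The full flow ignores the divisions, so any fixed sequence makes the reference curve
        -- deterministic.
        rw [splitFlow_const _ (fun k => ξ k ω₀)]
    _ = _ := by simp

/-- The law of the two coupled processes is invariant under every symmetry of the forces that
preserves the law of the initial datum. -/
theorem lintegral_comp_symmetry (hf : LipschitzWith L f) (hg : ∀ π, LipschitzWith L (g π))
    (hτ : 0 < τ) {ξ : ℕ → Ω → ι} (hξ : ∀ k, Measurable (ξ k))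
    (hunif : ∀ k π, P {ω | ξ k ω = π} = (Fintype.card ι : ℝ≥0∞)⁻¹) (hind : iIndepFun ξ P)
    {z₀ : Ω → H × H} (hz₀ : Measurable z₀) (hind₀ : IndepFun z₀ (fun ω k => ξ k ω) P)
    {Z Z' : Ω → ℝ → H × H}
    (hZ : ∀ᵐ ω ∂P, Z ω 0 = z₀ ω ∧ IsTrajectory (secondOrder f) T (Z ω))
    (hZ' : ∀ᵐ ω ∂P, Z' ω 0 = z₀ ω ∧
      IsSplitTrajectory (fun π => secondOrder (g π)) τ T (fun k => ξ k ω) (Z' ω))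
    {R : H →L[ℝ] H} {σ : ι ≃ ι} (hRf : ∀ y, f (R y) = R (f y))
    (hRg : ∀ π y, g (σ π) (R y) = R (g π y))
    (hR : P.map (fun ω => R.prodMap R (z₀ ω)) = P.map z₀)
    {φ : H × H → ℝ≥0∞} (hφ : Measurable φ) {t : ℝ} (ht : t ∈ Icc 0 T) :
    ∫⁻ ω, φ (R.prodMap R (Z ω t - Z' ω t)) ∂P = ∫⁻ ω, φ (Z ω t - Z' ω t) ∂P := by
  obtain ⟨m, s, hs, rfl, h, h'⟩ :=
    exists_ae_eq_splitFlow hf.secondOrder (fun π => (hg π).secondOrder) hτ hZ hZ' ht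
  have hτ' : τ ∈ Icc 0 τ := ⟨hτ.le, le_rfl⟩
  have hx : ∀ k, Measurable fun p : (H × H) × (ℕ → ι) => p.2 k := fun k =>
    (measurable_pi_apply k).comp measurable_snd
  have hσ : Measurable fun (x : ℕ → ι) k => σ (x k) :=
    measurable_pi_iff.2 fun k => (measurable_of_countable σ).comp (measurable_pi_apply k)
  have hR2 : Measurable (R.prodMap R) := (R.prodMap R).continuous.measurable
  have hξ' : Measurable fun ω k => ξ k ω := measurable_pi_iff.2 hξ
  set D : (H × H) × (ℕ → ι) → H × H := fun p =>
    splitFlow (fun _ => secondOrder f) τ τ p.2 m s p.1 -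
      splitFlow (fun π => secondOrder (g π)) τ τ p.2 m s p.1 with hD
  have hDm : Measurable D :=
    (measurable_splitFlow (fun _ => hf.secondOrder) hτ' hx measurable_fst m hs).sub
      (measurable_splitFlow (fun π => (hg π).secondOrder) hτ' hx measurable_fst m hs)
  have hDZ : ∀ᵐ ω ∂P, Z ω (m * τ + s) - Z' ω (m * τ + s) = D (z₀ ω, fun k => ξ k ω) := by
    filter_upwards [h, h'] with ω h1 h2
    rw [h1, h2]
  have hDR : ∀ z x, R.prodMap R (D (z, x)) = D (R.prodMap R z, fun k => σ (x k)) := by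
    intro z x
    simp only [hD, map_sub]
    rw [map_splitFlow (fun _ => hf.secondOrder) hτ' (R.prodMap R) σ
        (fun π w => by simp [secondOrder, hRf]) x m hs z,
      map_splitFlow (fun π => (hg π).secondOrder) hτ' (R.prodMap R) σ
        (fun π w => by simp [secondOrder, hRg]) x m hs z]
  have hlaw : P.map (fun ω => (R.prodMap R (z₀ ω), fun k => σ (ξ k ω))) =
      P.map (fun ω => (z₀ ω, fun k => ξ k ω)) := by
    have h1 : IndepFun (fun ω => R.prodMap R (z₀ ω)) (fun ω k => σ (ξ k ω)) P :=
      hind₀.comp hR2 hσ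
    refine ((indepFun_iff_map_prod_eq_prod_map_map (hR2.comp hz₀).aemeasurable
        (hσ.comp hξ').aemeasurable).1 h1).trans ?_
    rw [(indepFun_iff_map_prod_eq_prod_map_map hz₀.aemeasurable hξ'.aemeasurable).1 hind₀]
    -- The relabelled divisions are again independent and uniform, so both sequences have the same
    -- infinite product law.
    have h2 := (hind.comp (fun _ => σ) fun _ => measurable_of_countable _)
    have h3 := iIndepFun.map_fun_eq_infinitePi_map
      (fun k => (measurable_of_countable σ).comp (hξ k)) h2
    have h4 := iIndepFun.map_fun_eq_infinitePi_map hξ hind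
    simp only [map_equiv_comp_eq_of_uniform (hξ _) (hunif _)] at h3
    exact congrArg₂ Measure.prod hR (h3.trans h4.symm)
  calc _ = ∫⁻ ω, φ (D (R.prodMap R (z₀ ω), fun k => σ (ξ k ω))) ∂P := by
        refine lintegral_congr_ae ?_
        filter_upwards [hDZ] with ω h1
        rw [h1, hDR]
    _ = ∫⁻ p, φ (D p) ∂P.map (fun ω => (R.prodMap R (z₀ ω), fun k => σ (ξ k ω))) :=
        (lintegral_map (hφ.comp hDm) ((hR2.comp hz₀).prodMk (hσ.comp hξ'))).symm
    _ = ∫⁻ p, φ (D p) ∂P.map (fun ω => (z₀ ω, fun k => ξ k ω)) := by rw [hlaw]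
    _ = ∫⁻ ω, φ (D (z₀ ω, fun k => ξ k ω)) ∂P :=
        lintegral_map (hφ.comp hDm) (hz₀.prodMk hξ')
    _ = _ := by
        refine lintegral_congr_ae ?_
        filter_upwards [hDZ] with ω h1
        rw [h1]

end Random

/-! ### The moments of a random division -/

namespace BatchDivision

variable {N p : ℕ}

theorem mem_batch_self (π : BatchDivision N p) (i : Fin N) : i ∈ π.batch i :=
  π.1.mem_part_self.2 (Finset.mem_univ i)

theorem mem_batch_comm (π : BatchDivision N p) {i j : Fin N} : j ∈ π.batch i ↔ i ∈ π.batch j := by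
  unfold batch
  rw [π.1.mem_part_iff_part_eq_part (Finset.mem_univ _) (Finset.mem_univ _),
    π.1.mem_part_iff_part_eq_part (Finset.mem_univ _) (Finset.mem_univ _), eq_comm]

theorem card_batch (π : BatchDivision N p) (i : Fin N) : (π.batch i).card = p :=
  π.2 _ (π.1.part_mem.2 (Finset.mem_univ i))

/-- The division obtained by relabelling the particles. -/
def relabel (σ : Equiv.Perm (Fin N)) (π : BatchDivision N p) : BatchDivision N p :=
  ⟨Finpartition.ofExistsUnique (π.1.parts.map σ.finsetCongr.toEmbedding)
    (fun _ _ => Finset.subset_univ _)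
    (fun a _ => by
      obtain ⟨C, ⟨hC, ha⟩, huniq⟩ := π.1.existsUnique_mem (Finset.mem_univ (σ.symm a))
      refine ⟨σ.finsetCongr C,
        ⟨Finset.mem_map_of_mem σ.finsetCongr.toEmbedding hC, by simpa using ha⟩, ?_⟩
      rintro D ⟨hD, haD⟩
      obtain ⟨D', hD', rfl⟩ := Finset.mem_map.1 hD
      have := huniq D' ⟨hD', by simpa using haD⟩
      rw [this]; rfl)
    (fun h => by
      obtain ⟨D', hD', h0⟩ := Finset.mem_map.1 h
      have : D' = ∅ := by simpa using h0
      exact π.1.empty_notMem_parts (this ▸ hD')),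
   fun C hC => by
      obtain ⟨D', hD', rfl⟩ := Finset.mem_map.1 hC
      simpa using π.2 D' hD'⟩

theorem batch_relabel (σ : Equiv.Perm (Fin N)) (π : BatchDivision N p) (i : Fin N) :
    (π.relabel σ).batch (σ i) = (π.batch i).map σ.toEmbedding := by
  refine Finpartition.part_eq_of_mem _ ?_ ?_
  · exact Finset.mem_map_of_mem σ.finsetCongr.toEmbedding
      (π.1.part_mem.2 (Finset.mem_univ i))
  · simpa using π.mem_batch_self i

theorem relabel_relabel_symm (σ : Equiv.Perm (Fin N)) (π : BatchDivision N p) :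
    (π.relabel σ).relabel σ.symm = π := by
  refine Subtype.ext (Finpartition.ext ?_)
  change (π.1.parts.map σ.finsetCongr.toEmbedding).map σ.symm.finsetCongr.toEmbedding = π.1.parts
  rw [Finset.map_map]
  convert Finset.map_refl
  ext1 C
  simp [Finset.map_map]

/-- Relabelling the particles permutes the divisions. -/
def relabelEquiv (σ : Equiv.Perm (Fin N)) : BatchDivision N p ≃ BatchDivision N p where
  toFun := relabel σ
  invFun := relabel σ.symm
  left_inv := relabel_relabel_symm σ
  right_inv := relabel_relabel_symm σ.symm

/-- The weight of the particle `j` in the batch force on the particle `i`. -/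
noncomputable def weight (π : BatchDivision N p) (i j : Fin N) : ℝ :=
  if j ∈ (π.batch i).erase i then 1 / ((p : ℝ) - 1) else 0

theorem weight_self (π : BatchDivision N p) (i : Fin N) : π.weight i i = 0 := by simp [weight]

theorem weight_nonneg (hp : 2 ≤ p) (π : BatchDivision N p) (i j : Fin N) : 0 ≤ π.weight i j := by
  have : (2 : ℝ) ≤ p := by exact_mod_cast hp
  unfold weight
  split_ifs
  · exact one_div_nonneg.2 (by linarith)
  · exact le_rfl

theorem weight_comm (π : BatchDivision N p) (i j : Fin N) : π.weight i j = π.weight j i := by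
  simp only [weight, Finset.mem_erase, π.mem_batch_comm (i := i) (j := j), ne_comm]

theorem weight_relabel (σ : Equiv.Perm (Fin N)) (π : BatchDivision N p) (i j : Fin N) :
    (π.relabel σ).weight (σ i) (σ j) = π.weight i j := by
  simp [weight, batch_relabel]

theorem weight_mul_self (π : BatchDivision N p) (i j : Fin N) :
    π.weight i j * π.weight i j = π.weight i j / ((p : ℝ) - 1) := by
  unfold weight
  split_ifs <;> ring

theorem sum_weight (hp : 2 ≤ p) (π : BatchDivision N p) (i : Fin N) :
    ∑ j, π.weight i j = 1 := by
  have h2 : (2 : ℝ) ≤ p := by exact_mod_cast hp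
  have h1 : (p : ℝ) - 1 ≠ 0 := by linarith
  simp only [weight, Finset.sum_ite_mem, Finset.univ_inter, Finset.sum_const, nsmul_eq_mul]
  rw [Finset.card_erase_of_mem (π.mem_batch_self i), card_batch, Nat.cast_sub (by omega)]
  field_simp
  simp

theorem sum_relabel {M : Type*} [AddCommMonoid M] (σ : Equiv.Perm (Fin N))
    (φ : BatchDivision N p → M) : ∑ π, φ (relabel σ π) = ∑ π, φ π :=
  (relabelEquiv σ).sum_comp φ

/-- The transposition of `j` and `k` fixes `i` and permutes the divisions. -/
theorem sum_weight_eq_of_ne {i j k : Fin N} (hj : j ≠ i) (hk : k ≠ i) :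
    ∑ π : BatchDivision N p, π.weight i j = ∑ π : BatchDivision N p, π.weight i k := by
  rw [← sum_relabel (Equiv.swap j k) fun π => π.weight i k]
  refine Finset.sum_congr rfl fun π _ => ?_
  have := π.weight_relabel (Equiv.swap j k) i j
  rwa [Equiv.swap_apply_of_ne_of_ne hj.symm hk.symm, Equiv.swap_apply_left, eq_comm] at this

theorem two_le_of_ne {i j : Fin N} (h : j ≠ i) : (2 : ℝ) ≤ N := by
  have : 2 ≤ N := by
    have := i.2; have := j.2
    have : (j : ℕ) ≠ i := fun h' => h (Fin.ext h')
    omega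
  exact_mod_cast this

theorem sum_weight_division (hp : 2 ≤ p) {i j : Fin N} (hj : j ≠ i) :
    ∑ π : BatchDivision N p, π.weight i j =
      Fintype.card (BatchDivision N p) / ((N : ℝ) - 1) := by
  have hN := two_le_of_ne hj
  -- Every `k ≠ i` gives the same sum, so only the diagonal term survives; each row of weights sums
  -- to `1`.
  have h1 : ∑ k, (∑ π : BatchDivision N p, π.weight i k -
      ∑ π : BatchDivision N p, π.weight i j) = 0 - ∑ π : BatchDivision N p, π.weight i j := by
    rw [Fintype.sum_eq_single i fun k hk => by rw [sum_weight_eq_of_ne hk hj, sub_self]]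
    simp [weight_self]
  rw [Finset.sum_sub_distrib, Finset.sum_comm] at h1
  simp only [sum_weight hp, Finset.sum_const, Finset.card_univ, nsmul_eq_mul, mul_one,
    Fintype.card_fin] at h1
  rw [eq_div_iff (by linarith)]
  linarith

theorem sum_weight_mul_weight_eq {i j k l : Fin N} (hk : k ≠ i) (hkj : k ≠ j)
    (hl : l ≠ i) (hlj : l ≠ j) :
    ∑ π : BatchDivision N p, π.weight i j * π.weight i k =
      ∑ π : BatchDivision N p, π.weight i j * π.weight i l := by
  rw [← sum_relabel (Equiv.swap k l) fun π => π.weight i j * π.weight i l]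
  refine Finset.sum_congr rfl fun π _ => ?_
  have h1 := π.weight_relabel (Equiv.swap k l) i j
  have h2 := π.weight_relabel (Equiv.swap k l) i k
  rw [Equiv.swap_apply_of_ne_of_ne hk.symm hl.symm] at h1 h2
  rw [Equiv.swap_apply_of_ne_of_ne hkj.symm hlj.symm] at h1
  rw [Equiv.swap_apply_left] at h2
  rw [h1, h2]

theorem sum_weight_mul_self (hp : 2 ≤ p) {i j : Fin N} (hj : j ≠ i) :
    ∑ π : BatchDivision N p, π.weight i j * π.weight i j =
      Fintype.card (BatchDivision N p) / (((p : ℝ) - 1) * ((N : ℝ) - 1)) := by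
  simp only [weight_mul_self]
  rw [← Finset.sum_div, sum_weight_division hp hj, div_div, mul_comm ((p : ℝ) - 1)]

/-- Multiplying the row identity `∑ l, w i l = 1` by `w i j` leaves the diagonal second moment and
`N - 2` equal mixed moments. -/
theorem sum_weight_mul_weight (hp : 2 ≤ p) {i j k : Fin N} (hj : j ≠ i) (hk : k ≠ i)
    (hkj : k ≠ j) :
    ∑ π : BatchDivision N p, π.weight i j * π.weight i k =
      Fintype.card (BatchDivision N p) * ((p : ℝ) - 2) /
        (((p : ℝ) - 1) * ((N : ℝ) - 1) * ((N : ℝ) - 2)) := by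
  have hp' : (2 : ℝ) ≤ p := by exact_mod_cast hp
  have hN : (3 : ℝ) ≤ N := by
    have : 3 ≤ N := by
      have h1 : ({i, j, k} : Finset (Fin N)).card = 3 := Finset.card_eq_three.2
        ⟨i, j, k, hj.symm, hk.symm, hkj.symm, rfl⟩
      have h2 := Finset.card_le_univ ({i, j, k} : Finset (Fin N))
      rwa [h1, Fintype.card_fin] at h2
    exact_mod_cast this
  set c := ∑ π : BatchDivision N p, π.weight i j * π.weight i k with hc
  have h1 : ∑ l, (∑ π : BatchDivision N p, π.weight i j * π.weight i l - c) =
      (0 - c) + (∑ π : BatchDivision N p, π.weight i j * π.weight i j - c) := by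
    rw [Fintype.sum_eq_add i j hj.symm fun l hl => by
      rw [hc, sum_weight_mul_weight_eq hl.1 hl.2 hk hkj, sub_self]]
    simp [weight_self]
  rw [Finset.sum_sub_distrib, Finset.sum_comm] at h1
  simp only [← Finset.mul_sum, sum_weight hp, Finset.sum_const, Finset.card_univ, nsmul_eq_mul,
    mul_one, Fintype.card_fin, sum_weight_mul_self hp hj, sum_weight_division hp hj] at h1
  have e1 : (p : ℝ) - 1 ≠ 0 := by linarith
  have e2 : (N : ℝ) - 1 ≠ 0 := by linarith
  have e3 : (N : ℝ) - 2 ≠ 0 := by linarith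
  rw [eq_div_iff (by positivity)]
  field_simp at h1
  linear_combination (-1 : ℝ) * h1

open scoped RealInnerProductSpace in
/-- The variance of the batch average of bounded vectors is of order `1 / (p - 1)`. -/
theorem sum_norm_sub_sq_le {V : Type*} [NormedAddCommGroup V] [InnerProductSpace ℝ V]
    (hp : 2 ≤ p) (hpN : p ≤ N) (i : Fin N) {u : Fin N → V} {M : ℝ} (hu : ∀ j, ‖u j‖ ≤ M) :
    ∑ π : BatchDivision N p,
        ‖∑ j, π.weight i j • u j - (1 / ((N : ℝ) - 1)) • ∑ j ∈ Finset.univ.erase i, u j‖ ^ 2 ≤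
      Fintype.card (BatchDivision N p) * (M ^ 2 / ((p : ℝ) - 1)) := by
  have hp' : (2 : ℝ) ≤ p := by exact_mod_cast hp
  have hN' : (p : ℝ) ≤ N := by exact_mod_cast hpN
  set D : ℝ := (Fintype.card (BatchDivision N p) : ℝ) with hD
  have hD0 : 0 ≤ D := Nat.cast_nonneg _
  -- Setting the `i`-th vector to zero allows sums over all indices.
  set v : Fin N → V := fun j => if j = i then 0 else u j with hv
  set A : ℝ := D / (((p : ℝ) - 1) * ((N : ℝ) - 1)) with hA
  set β : ℝ := D * ((p : ℝ) - 2) / (((p : ℝ) - 1) * ((N : ℝ) - 1) * ((N : ℝ) - 2)) with hβ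
  have hv1 : ∑ j ∈ Finset.univ.erase i, u j = ∑ j, v j := by
    rw [← Finset.add_sum_erase _ _ (Finset.mem_univ i)]
    simp only [hv, if_true, zero_add]
    exact Finset.sum_congr rfl fun j hj => (if_neg (Finset.ne_of_mem_erase hj)).symm
  have hv2 : ∀ π : BatchDivision N p, ∑ j, π.weight i j • u j = ∑ j, π.weight i j • v j := by
    intro π
    refine Finset.sum_congr rfl fun j _ => ?_
    by_cases h : j = i
    · simp [h, weight_self]
    · simp [hv, h]
  have hmean : ∑ π : BatchDivision N p, ∑ j, π.weight i j • v j =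
      D • (1 / ((N : ℝ) - 1)) • ∑ j, v j := by
    rw [Finset.sum_comm, Finset.smul_sum, Finset.smul_sum]
    refine Finset.sum_congr rfl fun j _ => ?_
    by_cases h : j = i
    · simp [hv, h]
    · rw [← Finset.sum_smul, sum_weight_division hp h, smul_smul, ← hD, mul_one_div]
  have hsq : ∑ π : BatchDivision N p, ‖∑ j, π.weight i j • v j‖ ^ 2 =
      (A - β) * ∑ j, ‖v j‖ ^ 2 + β * ‖∑ j, v j‖ ^ 2 := by
    have h1 : ∀ j k, ∑ π : BatchDivision N p, π.weight i j * π.weight i k * ⟪v j, v k⟫ =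
        (if j = k then (A - β) * ‖v j‖ ^ 2 else 0) + β * ⟪v j, v k⟫ := by
      intro j k
      by_cases hj : j = i
      · simp [hv, hj]
      by_cases hk : k = i
      · simp [hv, hk, hj]
      rw [← Finset.sum_mul]
      by_cases hjk : j = k
      · subst hjk
        rw [sum_weight_mul_self hp hj, if_pos rfl, real_inner_self_eq_norm_sq]
        ring
      · rw [sum_weight_mul_weight hp hj hk (Ne.symm hjk), if_neg hjk, zero_add]
    calc _ = ∑ j, ∑ k, ∑ π : BatchDivision N p, π.weight i j * π.weight i k * ⟪v j, v k⟫ := by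
          simp only [← real_inner_self_eq_norm_sq, sum_inner, inner_sum, real_inner_smul_left,
            real_inner_smul_right]
          rw [Finset.sum_comm]
          refine Finset.sum_congr rfl fun j _ => ?_
          rw [Finset.sum_comm]
          refine Finset.sum_congr rfl fun k _ => Finset.sum_congr rfl fun π _ => ?_
          rw [real_inner_comm]
          ring
      _ = _ := by
          simp only [h1, Finset.sum_add_distrib, ← Finset.mul_sum, Finset.sum_ite_eq,
            Finset.mem_univ, if_true]
          simp only [← real_inner_self_eq_norm_sq (∑ j, v j), sum_inner, inner_sum]
          rw [Finset.sum_comm (f := fun i j => ⟪v i, v j⟫)]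
  set m := (1 / ((N : ℝ) - 1)) • ∑ j, v j with hm
  clear_value D A β
  have hvar : ∑ π : BatchDivision N p, ‖∑ j, π.weight i j • v j - m‖ ^ 2 =
      (A - β) * ∑ j, ‖v j‖ ^ 2 + β * ‖∑ j, v j‖ ^ 2 - D * ‖m‖ ^ 2 := by
    simp only [norm_sub_sq_real, Finset.sum_add_distrib, Finset.sum_sub_distrib, hsq,
      ← Finset.mul_sum, ← sum_inner, hmean, real_inner_smul_left, real_inner_self_eq_norm_sq,
      Finset.sum_const, Finset.card_univ, nsmul_eq_mul, ← hD]
    ring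
  clear hsq hmean hD
  have hmnorm : ‖m‖ ^ 2 = (1 / ((N : ℝ) - 1)) ^ 2 * ‖∑ j, v j‖ ^ 2 := by
    rw [hm, norm_smul, mul_pow, Real.norm_eq_abs, sq_abs]
  have hp1 : 0 < (p : ℝ) - 1 := by linarith
  have hN1 : 0 < (N : ℝ) - 1 := by linarith
  have hβ0 : 0 ≤ β := by
    have : 0 ≤ (p : ℝ) - 2 := by linarith
    have : 0 ≤ (N : ℝ) - 2 := by linarith
    rw [hβ]
    positivity
  have hβ1 : β ≤ D * (1 / ((N : ℝ) - 1)) ^ 2 := by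
    -- For `N = 2` the denominator of `β` vanishes, so `β = 0` by convention; no mixed pair exists
    -- then.
    rcases (show (2 : ℝ) ≤ N by linarith).eq_or_lt with h | h
    · rw [hβ, ← h]; simp; positivity
    · have hN2 : 0 < (N : ℝ) - 2 := by linarith
      rw [hβ, mul_div_assoc]
      refine mul_le_mul_of_nonneg_left ?_ hD0
      rw [one_div, inv_pow, inv_eq_one_div, div_le_div_iff₀ (by positivity) (by positivity)]
      -- The claim reduces to `(p - 2) * (N - 1) ≤ (p - 1) * (N - 2)`, that is, `p ≤ N`.
      nlinarith [mul_nonneg (sub_nonneg.2 hN') hN1.le]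
  have hsum : ∑ j, ‖v j‖ ^ 2 ≤ ((N : ℝ) - 1) * M ^ 2 := by
    have h1 : ∀ j, ‖v j‖ ^ 2 ≤ M ^ 2 - if j = i then M ^ 2 else 0 := by
      intro j
      by_cases h : j = i
      · simp [hv, h]
      · simp only [hv, h, if_false, sub_zero]
        have := hu j
        gcongr
    refine (Finset.sum_le_sum fun j _ => h1 j).trans (le_of_eq ?_)
    simp
    ring
  simp only [hv1, hv2, ← hm]
  rw [hvar, hmnorm]
  clear hvar hv2 hmnorm
  have hA0 : 0 ≤ A := by rw [hA]; positivity
  have h1 : A * (((N : ℝ) - 1) * M ^ 2) = D * (M ^ 2 / ((p : ℝ) - 1)) := by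
    rw [hA]; field_simp
  rw [← h1]
  have h2 := mul_le_mul_of_nonneg_left hsum hA0
  -- In the variance, `-β * ∑ ‖v j‖ ^ 2` is dropped, and `β * ‖∑ v j‖ ^ 2` is absorbed by the
  -- squared mean.
  have h3 : 0 ≤ β * ∑ j, ‖v j‖ ^ 2 :=
    mul_nonneg hβ0 (Finset.sum_nonneg fun j _ => sq_nonneg _)
  have h4 := mul_le_mul_of_nonneg_right hβ1 (sq_nonneg ‖∑ j, v j‖)
  linarith

end BatchDivision

/-! ### The forces on the particles as vector fields on a Hilbert space -/

section Forces

variable {d N p : ℕ}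

instance : MeasurableSingletonClass (BatchDivision N p) :=
  ⟨fun _ => MeasurableSpace.measurableSet_top⟩

/-- The weight of the particle `j` in the full force on the particle `i`. -/
noncomputable def fullWeight {N : ℕ} (i j : Fin N) : ℝ := if j = i then 0 else 1 / ((N : ℝ) - 1)

theorem fullWeight_nonneg (i j : Fin N) : 0 ≤ fullWeight i j := by
  unfold fullWeight
  split_ifs with h
  · exact le_rfl
  · have := BatchDivision.two_le_of_ne h
    exact one_div_nonneg.2 (by linarith)

theorem fullWeight_comm (i j : Fin N) : fullWeight i j = fullWeight j i := by
  simp only [fullWeight, eq_comm]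

theorem sum_fullWeight (hN : 2 ≤ N) (i : Fin N) : ∑ j, fullWeight i j = 1 := by
  have h2 : (2 : ℝ) ≤ N := by exact_mod_cast hN
  have h1 : (N : ℝ) - 1 ≠ 0 := by linarith
  have h : ∀ j, fullWeight i j = 1 / ((N : ℝ) - 1) - if j = i then 1 / ((N : ℝ) - 1) else 0 := by
    intro j
    unfold fullWeight
    split_ifs <;> simp
  simp only [h, Finset.sum_sub_distrib, Finset.sum_ite_eq', Finset.mem_univ, if_true,
    Finset.sum_const, Finset.card_univ, Fintype.card_fin, nsmul_eq_mul]
  field_simp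

theorem batchForce_eq_sum (K : EuclideanSpace ℝ (Fin d) → EuclideanSpace ℝ (Fin d))
    (π : BatchDivision N p) (x : Fin N → EuclideanSpace ℝ (Fin d)) (i : Fin N) :
    batchForce K π x i = ∑ j, π.weight i j • K (x i - x j) := by
  simp only [batchForce, BatchDivision.weight, ite_smul, zero_smul, Finset.sum_ite_mem,
    Finset.univ_inter, Finset.smul_sum]

theorem fullForce_eq_sum (K : EuclideanSpace ℝ (Fin d) → EuclideanSpace ℝ (Fin d))
    (x : Fin N → EuclideanSpace ℝ (Fin d)) (i : Fin N) :
    fullForce K x i = ∑ j, fullWeight i j • K (x i - x j) := by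
  rw [fullForce, ← Finset.add_sum_erase _ _ (Finset.mem_univ i), Finset.smul_sum]
  simp only [fullWeight, if_true, zero_smul, zero_add]
  exact Finset.sum_congr rfl fun j hj => by rw [if_neg (Finset.ne_of_mem_erase hj)]

theorem batchForce_relabel (K : EuclideanSpace ℝ (Fin d) → EuclideanSpace ℝ (Fin d))
    (σ : Equiv.Perm (Fin N)) (π : BatchDivision N p) (x : Fin N → EuclideanSpace ℝ (Fin d))
    (i : Fin N) :
    batchForce K (π.relabel σ) (fun k => x (σ.symm k)) i = batchForce K π x (σ.symm i) := by
  rw [batchForce_eq_sum, batchForce_eq_sum, ← Equiv.sum_comp σ]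
  refine Finset.sum_congr rfl fun j _ => ?_
  have := π.weight_relabel σ (σ.symm i) j
  rw [Equiv.apply_symm_apply] at this
  rw [this, Equiv.symm_apply_apply]

theorem fullForce_relabel (K : EuclideanSpace ℝ (Fin d) → EuclideanSpace ℝ (Fin d))
    (σ : Equiv.Perm (Fin N)) (x : Fin N → EuclideanSpace ℝ (Fin d)) (i : Fin N) :
    fullForce K (fun k => x (σ.symm k)) i = fullForce K x (σ.symm i) := by
  rw [fullForce_eq_sum, fullForce_eq_sum, ← Equiv.sum_comp σ]
  refine Finset.sum_congr rfl fun j _ => ?_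
  simp only [fullWeight, Equiv.symm_apply_apply, Equiv.eq_symm_apply]

/-- Schur's test: Cauchy–Schwarz uses that rows sum to `1`, and symmetry gives the same for columns.
The constant `2 * L` is therefore free of `N` and `p`. -/
theorem sum_norm_sub_sq_le_of_weight {V : Type*} [NormedAddCommGroup V] [NormedSpace ℝ V]
    {K : V → V} {L : NNReal} (hK : LipschitzWith L K) {a : Fin N → Fin N → ℝ}
    (ha : ∀ i j, 0 ≤ a i j) (hsymm : ∀ i j, a i j = a j i) (hsum : ∀ i, ∑ j, a i j = 1)
    (x y : Fin N → V) :
    ∑ i, ‖∑ j, a i j • K (x i - x j) - ∑ j, a i j • K (y i - y j)‖ ^ 2 ≤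
      (2 * L : ℝ) ^ 2 * ∑ i, ‖x i - y i‖ ^ 2 := by
  have h1 : ∀ i, ‖∑ j, a i j • K (x i - x j) - ∑ j, a i j • K (y i - y j)‖ ^ 2 ≤
      ∑ j, a i j * ((L : ℝ) ^ 2 * (2 * (‖x i - y i‖ ^ 2 + ‖x j - y j‖ ^ 2))) := by
    intro i
    have h2 : ‖∑ j, a i j • K (x i - x j) - ∑ j, a i j • K (y i - y j)‖ ≤
        ∑ j, a i j * (L * (‖x i - y i‖ + ‖x j - y j‖)) := by
      rw [← Finset.sum_sub_distrib]
      refine (norm_sum_le _ _).trans (Finset.sum_le_sum fun j _ => ?_)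
      rw [← smul_sub, norm_smul, Real.norm_of_nonneg (ha i j)]
      refine mul_le_mul_of_nonneg_left ((hK.norm_sub_le _ _).trans ?_) (ha i j)
      refine mul_le_mul_of_nonneg_left ?_ L.2
      have : x i - x j - (y i - y j) = (x i - y i) - (x j - y j) := by abel
      rw [this]
      exact norm_sub_le _ _
    calc _ ≤ (∑ j, a i j * (L * (‖x i - y i‖ + ‖x j - y j‖))) ^ 2 := by gcongr
      _ ≤ (∑ j, a i j) * ∑ j, a i j * (L * (‖x i - y i‖ + ‖x j - y j‖)) ^ 2 := by
          refine Finset.sum_sq_le_sum_mul_sum_of_sq_le_mul _ (fun j _ => ha i j)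
            (fun j _ => mul_nonneg (ha i j) (sq_nonneg _)) fun j _ => le_of_eq (by ring)
      _ ≤ _ := by
          rw [hsum, one_mul]
          refine Finset.sum_le_sum fun j _ => mul_le_mul_of_nonneg_left ?_ (ha i j)
          rw [mul_pow]
          refine mul_le_mul_of_nonneg_left ?_ (sq_nonneg _)
          linarith [sq_nonneg (‖x i - y i‖ - ‖x j - y j‖)]
  refine (Finset.sum_le_sum fun i _ => h1 i).trans (le_of_eq ?_)
  have h3 : ∑ i, ∑ j, a i j * ‖x j - y j‖ ^ 2 = ∑ j, ‖x j - y j‖ ^ 2 := by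
    rw [Finset.sum_comm]
    refine Finset.sum_congr rfl fun j _ => ?_
    simp only [hsymm _ j]
    rw [← Finset.sum_mul, hsum, one_mul]
  have h4 : ∑ i, ∑ j, a i j * ‖x i - y i‖ ^ 2 = ∑ j, ‖x j - y j‖ ^ 2 :=
    Finset.sum_congr rfl fun i _ => by rw [← Finset.sum_mul, hsum, one_mul]
  calc _ = 2 * (L : ℝ) ^ 2 * (∑ i, ∑ j, a i j * ‖x i - y i‖ ^ 2 +
        ∑ i, ∑ j, a i j * ‖x j - y j‖ ^ 2) := by
        simp only [← Finset.sum_add_distrib, Finset.mul_sum]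
        exact Finset.sum_congr rfl fun i _ => Finset.sum_congr rfl fun j _ => by ring
    _ = _ := by rw [h3, h4]; ring

/-- The Hilbert space of the configurations of `N` particles. -/
abbrev Configuration (d N : ℕ) : Type := PiLp 2 fun _ : Fin N => EuclideanSpace ℝ (Fin d)

/-- The force with external part `b` and interaction part `F`, on the Hilbert space of
configurations. -/
noncomputable def totalForce (b : EuclideanSpace ℝ (Fin d) → EuclideanSpace ℝ (Fin d))
    (F : (Fin N → EuclideanSpace ℝ (Fin d)) → Fin N → EuclideanSpace ℝ (Fin d))
    (x : Configuration d N) : Configuration d N :=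
  WithLp.toLp 2 fun i => b (x i) + F x.ofLp i

theorem totalForce_sub (b : EuclideanSpace ℝ (Fin d) → EuclideanSpace ℝ (Fin d))
    (F G : (Fin N → EuclideanSpace ℝ (Fin d)) → Fin N → EuclideanSpace ℝ (Fin d))
    (x : Configuration d N) (i : Fin N) :
    (totalForce b F x - totalForce b G x) i = F x.ofLp i - G x.ofLp i := by
  simp [totalForce]

theorem norm_le_mul_of_sum_sq_le {u w : Configuration d N} {c : ℝ} (hc : 0 ≤ c)
    (h : ∑ i, ‖u i‖ ^ 2 ≤ c ^ 2 * ∑ i, ‖w i‖ ^ 2) : ‖u‖ ≤ c * ‖w‖ := by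
  rw [← PiLp.norm_sq_eq_of_L2, ← PiLp.norm_sq_eq_of_L2, ← mul_pow] at h
  exact (pow_le_pow_iff_left₀ (norm_nonneg _) (by positivity) two_ne_zero).1 h

theorem lipschitzWith_totalForce {b : EuclideanSpace ℝ (Fin d) → EuclideanSpace ℝ (Fin d)}
    {F : (Fin N → EuclideanSpace ℝ (Fin d)) → Fin N → EuclideanSpace ℝ (Fin d)} {L L' : NNReal}
    (hb : LipschitzWith L b)
    (hF : ∀ x y, ∑ i, ‖F x i - F y i‖ ^ 2 ≤ (L' : ℝ) ^ 2 * ∑ i, ‖x i - y i‖ ^ 2) :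
    LipschitzWith (L + L') (totalForce b F) := by
  refine LipschitzWith.of_dist_le_mul fun x y => ?_
  rw [dist_eq_norm, dist_eq_norm]
  have h : totalForce b F x - totalForce b F y =
      (WithLp.toLp 2 fun i => b (x i) - b (y i) : Configuration d N) +
        WithLp.toLp 2 fun i => F x.ofLp i - F y.ofLp i := by
    ext1 i
    simp only [totalForce, PiLp.sub_apply, PiLp.add_apply]
    abel
  rw [h, NNReal.coe_add, add_mul]
  refine (norm_add_le _ _).trans (add_le_add ?_ ?_)
  · refine norm_le_mul_of_sum_sq_le L.2 ?_
    rw [Finset.mul_sum]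
    refine Finset.sum_le_sum fun i _ => ?_
    rw [← mul_pow]
    exact pow_le_pow_left₀ (norm_nonneg _) (hb.norm_sub_le _ _) 2
  · exact norm_le_mul_of_sum_sq_le L'.2 (hF _ _)

theorem lipschitzWith_totalForce_fullForce
    {b K : EuclideanSpace ℝ (Fin d) → EuclideanSpace ℝ (Fin d)} {L L' : NNReal}
    (hb : LipschitzWith L b) (hK : LipschitzWith L' K) (hN : 2 ≤ N) :
    LipschitzWith (L + 2 * L') (totalForce (N := N) b (fullForce K)) := by
  refine lipschitzWith_totalForce hb fun x y => ?_
  simp only [fullForce_eq_sum]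
  exact sum_norm_sub_sq_le_of_weight hK fullWeight_nonneg fullWeight_comm (sum_fullWeight hN) x y

theorem lipschitzWith_totalForce_batchForce
    {b K : EuclideanSpace ℝ (Fin d) → EuclideanSpace ℝ (Fin d)} {L L' : NNReal}
    (hb : LipschitzWith L b) (hK : LipschitzWith L' K) (hp : 2 ≤ p) (π : BatchDivision N p) :
    LipschitzWith (L + 2 * L') (totalForce b (batchForce K π)) := by
  refine lipschitzWith_totalForce hb fun x y => ?_
  simp only [batchForce_eq_sum]
  exact sum_norm_sub_sq_le_of_weight hK (π.weight_nonneg hp) π.weight_comm (π.sum_weight hp) x y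

theorem sum_totalForce_batchForce_sub (hp : 2 ≤ p)
    (b K : EuclideanSpace ℝ (Fin d) → EuclideanSpace ℝ (Fin d)) (x : Configuration d N) :
    ∑ π : BatchDivision N p,
      (totalForce b (batchForce K π) x - totalForce b (fullForce K) x) = 0 := by
  ext1 i
  rw [WithLp.ofLp_sum, Finset.sum_apply]
  simp only [totalForce_sub, batchForce_eq_sum, fullForce_eq_sum, Finset.sum_sub_distrib]
  rw [Finset.sum_comm, Finset.sum_const, Finset.smul_sum, ← Finset.sum_sub_distrib]
  refine Finset.sum_eq_zero fun j _ => ?_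
  rw [← Finset.sum_smul, ← Nat.cast_smul_eq_nsmul ℝ, smul_smul, ← sub_smul]
  by_cases h : j = i
  · simp [h, BatchDivision.weight_self, fullWeight]
  · rw [BatchDivision.sum_weight_division hp h, fullWeight, if_neg h, Finset.card_univ,
      mul_one_div, sub_self, zero_smul]

/-- The squared norm collects `N` particles, whence the factor `N`, cancelled at the end by the
average over particles. -/
theorem sum_norm_totalForce_batchForce_sub_sq_le (hp : 2 ≤ p) (hpN : p ≤ N)
    (b : EuclideanSpace ℝ (Fin d) → EuclideanSpace ℝ (Fin d))
    {K : EuclideanSpace ℝ (Fin d) → EuclideanSpace ℝ (Fin d)} {M : ℝ} (hM : ∀ x, ‖K x‖ ≤ M)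
    (x : Configuration d N) :
    ∑ π : BatchDivision N p,
      ‖totalForce b (batchForce K π) x - totalForce b (fullForce K) x‖ ^ 2 ≤
      Fintype.card (BatchDivision N p) * √(N * (M ^ 2 / ((p : ℝ) - 1))) ^ 2 := by
  have hp' : (2 : ℝ) ≤ p := by exact_mod_cast hp
  have h1 : 0 ≤ M ^ 2 / ((p : ℝ) - 1) := div_nonneg (sq_nonneg _) (by linarith)
  rw [Real.sq_sqrt (by positivity)]
  have hn : ∀ z : Configuration d N, ‖z‖ ^ 2 = ∑ i, ‖z i‖ ^ 2 := fun z =>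
    PiLp.norm_sq_eq_of_L2 _ z
  simp only [hn, totalForce_sub]
  rw [Finset.sum_comm]
  refine (Finset.sum_le_sum fun i _ => ?_).trans_eq (b := ∑ _i : Fin N,
    (Fintype.card (BatchDivision N p) : ℝ) * (M ^ 2 / ((p : ℝ) - 1))) ?_
  · simp only [batchForce_eq_sum, fullForce]
    exact BatchDivision.sum_norm_sub_sq_le hp hpN i fun j => hM _
  · rw [Finset.sum_const, Finset.card_univ, Fintype.card_fin, nsmul_eq_mul]
    ring

/-- The point of phase space with given positions and velocities. -/
noncomputable def toPhase (w : (Fin N → EuclideanSpace ℝ (Fin d)) ×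
    (Fin N → EuclideanSpace ℝ (Fin d))) : Configuration d N × Configuration d N :=
  (WithLp.toLp 2 w.1, WithLp.toLp 2 w.2)

theorem hasDerivWithinAt_toLp {V : Type*} [NormedAddCommGroup V] [NormedSpace ℝ V]
    {x : ℝ → Fin N → V} {x' : Fin N → V} {s : Set ℝ} {t : ℝ}
    (h : ∀ i, HasDerivWithinAt (fun s => x s i) (x' i) s t) :
    HasDerivWithinAt (fun s => (WithLp.toLp 2 (x s) : PiLp 2 fun _ : Fin N => V))
      (WithLp.toLp 2 x') s t := by
  have h1 : HasDerivWithinAt x x' s t := hasDerivWithinAt_pi.2 h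
  exact (PiLp.hasFDerivAt_toLp (𝕜 := ℝ) (E := fun _ : Fin N => V) 2 (x t)).comp_hasDerivWithinAt
    t h1

theorem IsFullSolution.isTrajectory {b K : EuclideanSpace ℝ (Fin d) → EuclideanSpace ℝ (Fin d)}
    {T : ℝ} {x₀ v₀ : Fin N → EuclideanSpace ℝ (Fin d)}
    {x v : ℝ → Fin N → EuclideanSpace ℝ (Fin d)} (h : IsFullSolution b K T x₀ v₀ x v) :
    IsTrajectory (secondOrder (totalForce b (fullForce K))) T (fun t => toPhase (x t, v t)) := by
  have hd := fun t (ht : t ∈ Icc 0 T) => (hasDerivWithinAt_toLp (x := x) (x' := v t)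
    fun i => h.deriv_pos i t ht).prodMk (hasDerivWithinAt_toLp (x := v)
      (x' := fun i => b (x t i) + fullForce K (x t) i) fun i => h.deriv_vel i t ht)
  exact ⟨fun t ht => (hd t ht).continuousWithinAt, fun t ht =>
    (hd t ⟨ht.1, ht.2.le⟩).mono_of_mem_nhdsWithin
      (Filter.mem_of_superset (Icc_mem_nhdsGE ht.2) (Icc_subset_Icc_left ht.1))⟩

theorem IsRBMSolution.isSplitTrajectory
    {b K : EuclideanSpace ℝ (Fin d) → EuclideanSpace ℝ (Fin d)} {τ T : ℝ} (hτ : 0 < τ)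
    {ξ : ℕ → BatchDivision N p} {x₀ v₀ : Fin N → EuclideanSpace ℝ (Fin d)}
    {x u : ℝ → Fin N → EuclideanSpace ℝ (Fin d)} (h : IsRBMSolution b K τ T ξ x₀ v₀ x u) :
    IsSplitTrajectory (fun π => secondOrder (totalForce b (batchForce K π))) τ T ξ
      (fun t => toPhase (x t, u t)) where
  cont := ((PiLp.continuous_toLp 2 _).comp_continuousOn h.cont_pos).prodMk
    ((PiLp.continuous_toLp 2 _).comp_continuousOn h.cont_vel)
  deriv m t ht htT := by
    have ht0 : 0 ≤ t := le_trans (by positivity) ht.1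
    have ht' : t ∈ Icc 0 T ∩ Ico (m * τ) ((m + 1) * τ) := ⟨⟨ht0, htT.le⟩, ht⟩
    have hd := (hasDerivWithinAt_toLp (x := x) (x' := u t)
      fun i => h.deriv_pos m i t ht').prodMk (hasDerivWithinAt_toLp (x := u)
        (x' := fun i => b (x t i) + batchForce K (ξ m) (x t) i) fun i => h.deriv_vel m i t ht')
    refine hd.mono_of_mem_nhdsWithin (Filter.inter_mem ?_ ?_)
    · exact Filter.mem_of_superset (Icc_mem_nhdsGE htT) (Icc_subset_Icc_left ht0)
    · exact Filter.mem_of_superset (Ico_mem_nhdsGE ht.2) (Ico_subset_Ico_left ht.1)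

/-- The relabelling of the particles, on the Hilbert space of configurations. -/
noncomputable def relabelCLM (σ : Equiv.Perm (Fin N)) : Configuration d N →L[ℝ] Configuration d N :=
  (LinearIsometryEquiv.piLpCongrLeft 2 ℝ (EuclideanSpace ℝ (Fin d))
    σ).toContinuousLinearEquiv.toContinuousLinearMap

theorem totalForce_fullForce_relabel
    (b K : EuclideanSpace ℝ (Fin d) → EuclideanSpace ℝ (Fin d)) (σ : Equiv.Perm (Fin N))
    (x : Configuration d N) :
    totalForce b (fullForce K) (relabelCLM σ x) =
      relabelCLM σ (totalForce b (fullForce K) x) := by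
  ext1 i
  exact congrArg (b (x (σ.symm i)) + ·) (fullForce_relabel K σ x.ofLp i)

theorem totalForce_batchForce_relabel
    (b K : EuclideanSpace ℝ (Fin d) → EuclideanSpace ℝ (Fin d)) (σ : Equiv.Perm (Fin N))
    (π : BatchDivision N p) (x : Configuration d N) :
    totalForce b (batchForce K (π.relabel σ)) (relabelCLM σ x) =
      relabelCLM σ (totalForce b (batchForce K π) x) := by
  ext1 i
  exact congrArg (b (x (σ.symm i)) + ·) (batchForce_relabel K σ π x.ofLp i)

/-- The initial point of phase space, as a function of the positions and velocities. -/
noncomputable def initialPhase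
    (w : Fin N → EuclideanSpace ℝ (Fin d) × EuclideanSpace ℝ (Fin d)) :
    Configuration d N × Configuration d N :=
  toPhase (fun i => (w i).1, fun i => (w i).2)

theorem measurable_initialPhase : Measurable (initialPhase (d := d) (N := N)) := by
  refine Measurable.prodMk ?_ ?_
  · exact (WithLp.measurable_toLp 2 _).comp
      (measurable_pi_iff.2 fun i => measurable_fst.comp (measurable_pi_apply i))
  · exact (WithLp.measurable_toLp 2 _).comp
      (measurable_pi_iff.2 fun i => measurable_snd.comp (measurable_pi_apply i))

/-- The joint law is a product of identical factors, hence invariant under permutation. -/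
theorem map_relabel_initialPhase {Ω : Type*} [MeasurableSpace Ω] {P : Measure Ω}
    [IsProbabilityMeasure P]
    {W : Fin N → Ω → EuclideanSpace ℝ (Fin d) × EuclideanSpace ℝ (Fin d)}
    {ν : Measure (EuclideanSpace ℝ (Fin d) × EuclideanSpace ℝ (Fin d))}
    (hW : ∀ i, Measurable (W i)) (hind : iIndepFun W P) (hν : ∀ i, P.map (W i) = ν)
    (σ : Equiv.Perm (Fin N)) :
    P.map (fun ω => (relabelCLM σ).prodMap (relabelCLM σ) (initialPhase fun i => W i ω)) =
      P.map fun ω => initialPhase fun i => W i ω := by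
  have h1 := (iIndepFun_iff_map_fun_eq_pi_map fun i => (hW i).aemeasurable).1 hind
  have h2 := (iIndepFun_iff_map_fun_eq_pi_map fun i => (hW (σ.symm i)).aemeasurable).1
    (hind.precomp σ.symm.injective)
  simp only [hν] at h1 h2
  calc _ = P.map (initialPhase ∘ fun ω i => W (σ.symm i) ω) := rfl
    _ = (P.map fun ω i => W (σ.symm i) ω).map initialPhase :=
        (Measure.map_map measurable_initialPhase (measurable_pi_iff.2 fun i => hW _)).symm
    _ = (P.map fun ω i => W i ω).map initialPhase := by rw [h1, h2]
    _ = _ := Measure.map_map measurable_initialPhase (measurable_pi_iff.2 hW)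

end Forces

/-! ### The main theorem -/

section Main

variable {d N : ℕ}

/-- The contribution of the particle `i` to the squared norm on phase space. -/
noncomputable def particleSq (i : Fin N) (w : Configuration d N × Configuration d N) : ℝ :=
  ‖w.1 i‖ ^ 2 + ‖w.2 i‖ ^ 2

theorem particleSq_nonneg (i : Fin N) (w : Configuration d N × Configuration d N) :
    0 ≤ particleSq i w := by unfold particleSq; positivity

theorem measurable_particleSq (i : Fin N) : Measurable (particleSq (d := d) i) := by
  have : Continuous (particleSq (d := d) i) := by unfold particleSq; fun_prop
  exact this.measurable

theorem phaseSq_eq_sum (w : Configuration d N × Configuration d N) :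
    phaseSq w = ∑ i, particleSq i w := by
  simp only [phaseSq, particleSq, Finset.sum_add_distrib]
  exact congrArg₂ (· + ·) (PiLp.norm_sq_eq_of_L2 _ w.1) (PiLp.norm_sq_eq_of_L2 _ w.2)

theorem particleSq_relabel (σ : Equiv.Perm (Fin N)) (i : Fin N)
    (w : Configuration d N × Configuration d N) :
    particleSq i ((relabelCLM σ).prodMap (relabelCLM σ) w) = particleSq (σ.symm i) w := rfl

/-- The constant of the error bound for the random batch method. -/
noncomputable def batchConst (L M T : ℝ) : ℝ :=
  √(Real.exp (stepRate L * T) * (stepConst L T * T) * M ^ 2)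

theorem rootMean_le_ofReal {Ω : Type*} [MeasurableSpace Ω] {P : Measure Ω} {f : Ω → ℝ} {c : ℝ}
    (h : ∫⁻ ω, ENNReal.ofReal (f ω) ∂P ≤ ENNReal.ofReal c) :
    rootMean P f ≤ ENNReal.ofReal √c := by
  rcases le_or_gt 0 c with hc | hc
  · refine (ENNReal.rpow_le_rpow h (by norm_num)).trans_eq ?_
    rw [ENNReal.ofReal_rpow_of_nonneg hc (by norm_num), Real.sqrt_eq_rpow]
  · rw [ENNReal.ofReal_of_nonpos hc.le, nonpos_iff_eq_zero] at h
    simp [rootMean, h]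

end Main

theorem mainTheorem3 (d : ℕ)
    (b K : EuclideanSpace ℝ (Fin d) → EuclideanSpace ℝ (Fin d))
    (hb : ContDiff ℝ 1 b) (hb_bdd : ∃ M : ℝ, ∀ x, ‖b x‖ ≤ M)
    (hb_deriv : ∃ M : ℝ, ∀ x, ‖fderiv ℝ b x‖ ≤ M)
    (hK_bdd : ∃ M : ℝ, ∀ x, ‖K x‖ ≤ M) (hK_lip : ∃ L, LipschitzWith L K)
    (T : ℝ) (hT : 0 < T) :
    ∃ C : ℝ, 0 < C ∧
      ∀ (N p : ℕ), 0 < N → 2 ≤ p → p ∣ N →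
      ∀ (τ : ℝ), 0 < τ →
      ∀ (Ω : Type*) [MeasurableSpace Ω] (P : Measure Ω) [IsProbabilityMeasure P]
        -- i.i.d. initial data, shared by the two systems
        (X₀ V₀ : Fin N → Ω → EuclideanSpace ℝ (Fin d))
        (ν : Measure (EuclideanSpace ℝ (Fin d) × EuclideanSpace ℝ (Fin d)))
        -- the random divisions, drawn afresh at the times `m τ`
        (ξ : ℕ → Ω → BatchDivision N p)
        -- position and velocity in the full system and in RBM-1
        (X V X' U : Ω → ℝ → Fin N → EuclideanSpace ℝ (Fin d)),
        (∀ i, Measurable (X₀ i)) → (∀ i, Measurable (V₀ i)) →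
        iIndepFun (fun i ω => (X₀ i ω, V₀ i ω)) P →
        (∀ i, P.map (fun ω => (X₀ i ω, V₀ i ω)) = ν) →
        (∀ m, IsUniformDivision P (ξ m)) →
        iIndepFun ξ P →
        IndepFun (fun ω i => (X₀ i ω, V₀ i ω)) (fun ω m => ξ m ω) P →
        (∀ᵐ ω ∂P, IsFullSolution b K T (fun i => X₀ i ω) (fun i => V₀ i ω) (X ω) (V ω)) →
        (∀ᵐ ω ∂P, IsRBMSolution b K τ T (fun m => ξ m ω) (fun i => X₀ i ω) (fun i => V₀ i ω)
          (X' ω) (U ω)) →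
        ∀ i : Fin N,
          (⨆ t ∈ Icc (0 : ℝ) T, rootMean P (fun ω => (1 / (N : ℝ)) *
              ∑ j, (‖X ω t j - X' ω t j‖ ^ 2 + ‖V ω t j - U ω t j‖ ^ 2))) =
            (⨆ t ∈ Icc (0 : ℝ) T, rootMean P (fun ω =>
              ‖X ω t i - X' ω t i‖ ^ 2 + ‖V ω t i - U ω t i‖ ^ 2)) ∧
          (⨆ t ∈ Icc (0 : ℝ) T, rootMean P (fun ω =>
              ‖X ω t i - X' ω t i‖ ^ 2 + ‖V ω t i - U ω t i‖ ^ 2)) ≤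
            ENNReal.ofReal (C * √(τ / ((p : ℝ) - 1))) := by
  obtain ⟨Mb, hMb⟩ := hb_deriv
  obtain ⟨MK, hMK⟩ := hK_bdd
  obtain ⟨LK, hLK⟩ := hK_lip
  have hbL : LipschitzWith Mb.toNNReal b :=
    lipschitzWith_of_nnnorm_fderiv_le (𝕜 := ℝ) (hb.differentiable one_ne_zero) fun x =>
      NNReal.le_toNNReal_of_coe_le (hMb x)
  set L : NNReal := Mb.toNNReal + 2 * LK with hL
  -- The maximum with `1` keeps the final constant positive even when `K = 0`.
  set M : ℝ := max MK 1 with hM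
  have hM0 : 0 < M := one_pos.trans_le (le_max_right _ _)
  have hKM : ∀ x, ‖K x‖ ≤ M := fun x => (hMK x).trans (le_max_left _ _)
  have hC := stepConst_pos (L := L) hT.le
  refine ⟨batchConst L M T, Real.sqrt_pos.2 (by positivity), ?_⟩
  intro N p hN hp hpN τ hτ Ω _ P _ X₀ V₀ ν ξ X V X' U hX₀ hV₀ hindX hν hξ hindξ hind hXV hXU i
  have hpN' : p ≤ N := Nat.le_of_dvd hN hpN
  have hp' : (2 : ℝ) ≤ p := by exact_mod_cast hp
  have hN' : (0 : ℝ) < N := by exact_mod_cast hN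
  set f : Configuration d N → Configuration d N := totalForce b (fullForce K) with hf
  set g : BatchDivision N p → Configuration d N → Configuration d N :=
    fun π => totalForce b (batchForce K π) with hg
  have hfL : LipschitzWith L f := lipschitzWith_totalForce_fullForce hbL hLK (hp.trans hpN')
  have hgL : ∀ π, LipschitzWith L (g π) := lipschitzWith_totalForce_batchForce hbL hLK hp
  set W : Fin N → Ω → EuclideanSpace ℝ (Fin d) × EuclideanSpace ℝ (Fin d) :=
    fun i ω => (X₀ i ω, V₀ i ω) with hW
  have hWm : ∀ i, Measurable (W i) := fun i => (hX₀ i).prodMk (hV₀ i)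
  set z₀ : Ω → Configuration d N × Configuration d N := fun ω => initialPhase fun i => W i ω
    with hz₀
  have hz₀m : Measurable z₀ := measurable_initialPhase.comp (measurable_pi_iff.2 hWm)
  have hind₀ : IndepFun z₀ (fun ω k => ξ k ω) P := hind.comp measurable_initialPhase measurable_id
  set Z : Ω → ℝ → Configuration d N × Configuration d N := fun ω t => toPhase (X ω t, V ω t)
    with hZ
  set Z' : Ω → ℝ → Configuration d N × Configuration d N := fun ω t => toPhase (X' ω t, U ω t)
    with hZ'
  have hZ1 : ∀ᵐ ω ∂P, Z ω 0 = z₀ ω ∧ IsTrajectory (secondOrder f) T (Z ω) := by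
    filter_upwards [hXV] with ω h
    refine ⟨?_, h.isTrajectory⟩
    simp only [hZ, h.init_pos, h.init_vel]
    rfl
  have hZ2 : ∀ᵐ ω ∂P, Z' ω 0 = z₀ ω ∧
      IsSplitTrajectory (fun π => secondOrder (g π)) τ T (fun k => ξ k ω) (Z' ω) := by
    filter_upwards [hXU] with ω h
    refine ⟨?_, h.isSplitTrajectory hτ⟩
    simp only [hZ', h.init_pos, h.init_vel]
    rfl
  have hξm : ∀ k, Measurable (ξ k) := fun k => (hξ k).1
  have hunif := fun k => (hξ k).2
  have hexch : ∀ t ∈ Icc 0 T, ∀ j,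
      ∫⁻ ω, ENNReal.ofReal (particleSq j (Z ω t - Z' ω t)) ∂P =
        ∫⁻ ω, ENNReal.ofReal (particleSq i (Z ω t - Z' ω t)) ∂P := by
    intro t ht j
    -- The transposition of `i` and `j` carries the error of one particle to the other.
    have h := lintegral_comp_symmetry hfL hgL hτ hξm hunif hindξ hz₀m hind₀ hZ1 hZ2
      (R := relabelCLM (Equiv.swap i j)) (σ := BatchDivision.relabelEquiv (Equiv.swap i j))
      (totalForce_fullForce_relabel b K _) (totalForce_batchForce_relabel b K _)
      (map_relabel_initialPhase hWm hindX hν _) (measurable_particleSq i).ennreal_ofReal ht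
    rw [← h]
    refine lintegral_congr fun ω => ?_
    rw [particleSq_relabel, Equiv.symm_swap, Equiv.swap_apply_left]
  have hae : ∀ t ∈ Icc 0 T, ∀ j,
      AEMeasurable (fun ω => ENNReal.ofReal (particleSq j (Z ω t - Z' ω t))) P := fun t ht j =>
    (measurable_particleSq j).ennreal_ofReal.comp_aemeasurable
      (aemeasurable_sub_of_isSplitTrajectory hfL.secondOrder
        (fun π => (hgL π).secondOrder) hτ hξm hz₀m hZ1 hZ2 ht)
  have hmeanSq : ∀ t ∈ Icc 0 T,
      ∫⁻ ω, ENNReal.ofReal ((1 / (N : ℝ)) * ∑ j, particleSq j (Z ω t - Z' ω t)) ∂P =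
        ∫⁻ ω, ENNReal.ofReal (particleSq i (Z ω t - Z' ω t)) ∂P := by
    intro t ht
    have h1 : ∀ ω, ENNReal.ofReal ((1 / (N : ℝ)) * ∑ j, particleSq j (Z ω t - Z' ω t)) =
        ENNReal.ofReal (1 / (N : ℝ)) * ∑ j, ENNReal.ofReal (particleSq j (Z ω t - Z' ω t)) := by
      intro ω
      rw [ENNReal.ofReal_mul (by positivity),
        ENNReal.ofReal_sum_of_nonneg fun j _ => particleSq_nonneg _ _]
    simp only [h1]
    rw [lintegral_const_mul' _ _ ENNReal.ofReal_ne_top,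
      lintegral_finsetSum' _ fun j _ => hae t ht j]
    simp only [hexch t ht, Finset.sum_const, Finset.card_univ, Fintype.card_fin, nsmul_eq_mul]
    rw [← mul_assoc, ← ENNReal.ofReal_natCast N, ← ENNReal.ofReal_mul (by positivity),
      one_div_mul_cancel hN'.ne', ENNReal.ofReal_one, one_mul]
  have hbound : ∀ t ∈ Icc 0 T,
      ∫⁻ ω, ENNReal.ofReal (particleSq i (Z ω t - Z' ω t)) ∂P ≤
        ENNReal.ofReal (Real.exp (stepRate L * T) * (stepConst L T * T) * M ^ 2 *
          (τ / ((p : ℝ) - 1))) := by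
    intro t ht
    have h := lintegral_phaseSq_sub_le hfL hgL (sum_totalForce_batchForce_sub hp b K)
      (sum_norm_totalForce_batchForce_sub_sq_le hp hpN' b hKM) hT hτ hξm hunif hindξ hz₀m hind₀
      hZ1 hZ2 ht
    have h1 : ∀ ω, ENNReal.ofReal ((1 / (N : ℝ)) * ∑ j, particleSq j (Z ω t - Z' ω t)) =
        ENNReal.ofReal (1 / (N : ℝ)) * ENNReal.ofReal (phaseSq (Z' ω t - Z ω t)) := by
      intro ω
      rw [← phaseSq_eq_sum, ENNReal.ofReal_mul (by positivity)]
      simp only [phaseSq, Prod.fst_sub, Prod.snd_sub, norm_sub_rev]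
    -- The single-particle error is turned back into the average, to which the phase space bound
    -- applies.
    rw [← hmeanSq t ht]
    simp only [h1]
    rw [lintegral_const_mul' _ _ ENNReal.ofReal_ne_top]
    refine (mul_le_mul_right h _).trans (le_of_eq ?_)
    have h2 : 0 ≤ M ^ 2 / ((p : ℝ) - 1) := div_nonneg (sq_nonneg _) (by linarith)
    rw [← ENNReal.ofReal_mul (by positivity), Real.sq_sqrt (by positivity)]
    congr 1
    field_simp
  refine ⟨iSup_congr fun t => iSup_congr fun ht => ?_, iSup₂_le fun t ht => ?_⟩
  · exact congrArg (· ^ (1 / 2 : ℝ)) (hmeanSq t ht)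
  · rw [batchConst, ← Real.sqrt_mul (by positivity)]
    exact rootMean_le_ofReal (hbound t ht)
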